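/- Let $K$ be a field, let $Q$ be a finite, non-empty, connected quiver with $n$ vertices, let $J$ be the two-sided ideal of the path algebra $KQ$ generated by the arrows, and let $A$ be a $K$-algebra isomorphic to $KQ/J^2$ (a radical square zero algebra). Modules are finitely generated right $A$-modules, and $\Omega M$ (resp. $\Omega^{-1}M$) denotes the kernel of a projective cover (resp. the cokernel of an injective envelope) of $M$. Let $K_0$ be the quotient of the free abelian group on the symbols $[M]$, one for each isomorphism class of modules, by the relations $[M]-[M']-[M'']$ whenever $M\cong M'\oplus M''$, and $[P]$ for $P$ projective. Let $\overline{\Omega}\colon K_0\to K_0$ be the endomorphism $[M]\mapsto[\Omega M]$, and let $\langle \mathrm{add}\,M\rangle\subseteq K_0$ be the subgroup generated by the classes of the indecomposable direct summands of $M$. The Igusa–Todorov function is $$\phi(M)=\min\{\,l\in\mathbb N : \overline{\Omega}\text{ is injective on }\overline{\Omega}^{\,l+s}\langle \mathrm{add}\,M\rangle \text{ for all } s\in\mathbb N\,\},$$ and $\phi\dim(A)=\sup_M \phi(M)$. Put $A_0=KQ/J$. The heart of $Q$ is the full subquiver on the vertices whose simple modules occur both in the support of $\Omega^{n}(A_0)$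 and in the support of $\Omega^{-n}(A_0)$; the member $M(Q)$ is the full subquiver on the remaining vertices. One says that $A$ has maximal $\phi$-dimension if $\phi\dim(A)=n$ in case $M(Q)$ is empty, and $\phi\dim(A)=n-1$ in case $M(Q)$ is not empty. Suppose that $A$ has maximal $\phi$-dimension. Then there are indecomposable modules $M_1$ and $M_2$ such that $\phi(M_1\oplus M_2)=\phi\dim(A)$. -/

import Mathlib

universe u v w

namespace IgusaTodorov

/-! ### Projective covers, injective envelopes, syzygies and cosyzygies

Modules are left modules over a ring `R`; right `A`-modules are left modules over `Aᵐᵒᵖ`. -/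

section Modules

variable {R : Type u} [Ring R]

variable (R) in
/-- A module is indecomposable if it is nonzero and is not the internal direct sum of two nonzero
submodules. -/
def IsIndecomposable (M : Type v) [AddCommGroup M] [Module R M] : Prop :=
  Nontrivial M ∧ ∀ N N' : Submodule R M, IsCompl N N' → N = ⊥ ∨ N' = ⊥

/-- `f : P → M` is a projective cover: `P` is projective, `f` is onto and `ker f` is superfluous. -/
structure IsProjectiveCover {P : Type v} {M : Type w} [AddCommGroup P] [Module R P]
    [AddCommGroup M] [Module R M] (f : P →ₗ[R] M) : Prop where
  projective : Module.Projective R P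
  surjective : Function.Surjective f
  superfluous : ∀ X : Submodule R P, X ⊔ LinearMap.ker f = ⊤ → X = ⊤

/-- `i : M → E` is an injective envelope: `E` is an injective module, `i` is one-to-one and its
image is essential in `E`. -/
structure IsInjectiveEnvelope {M : Type v} {E : Type w} [AddCommGroup M] [Module R M]
    [AddCommGroup E] [Module R E] (i : M →ₗ[R] E) : Prop where
  injective_module : Module.Injective R E
  injective : Function.Injective i
  essential : ∀ X : Submodule R E, X ⊓ LinearMap.range i = ⊥ → X = ⊥

theorem exists_isProjectiveCover [IsArtinianRing R] (M : FGModuleCat.{u} R) :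
    ∃ (P : FGModuleCat.{u} R) (f : P →ₗ[R] M), IsProjectiveCover f := by
  obtain ⟨n, F, hF⟩ := Module.Finite.exists_fin' R M
  let S : Set (Submodule R (Fin n → R)) :=
    {Q | Module.Projective R Q ∧ Function.Surjective (F.comp Q.subtype)}
  have hS : S.Nonempty := by
    refine ⟨⊤, Module.Projective.of_equiv (Submodule.topEquiv (R := R) (M := Fin n → R)).symm, ?_⟩
    intro m
    obtain ⟨x, hx⟩ := hF m
    exact ⟨⟨x, trivial⟩, hx⟩
  obtain ⟨Q, ⟨hQp, hQs⟩, hmin⟩ := IsArtinian.set_has_minimal S hS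
  refine ⟨FGModuleCat.of R Q, F.comp Q.subtype, hQp, hQs, ?_⟩
  change ∀ X : Submodule R Q, X ⊔ LinearMap.ker (F.comp Q.subtype) = ⊤ → X = ⊤
  intro X hX
  set f : Q →ₗ[R] M := F.comp Q.subtype with hf
  have hXs : Function.Surjective (f.comp X.subtype) := by
    intro m
    obtain ⟨q, rfl⟩ := hQs m
    obtain ⟨x, hx, y, hy, rfl⟩ := Submodule.mem_sup.1 (hX ▸ Submodule.mem_top : q ∈ X ⊔ LinearMap.ker f)
    refine ⟨⟨x, hx⟩, ?_⟩
    have : f y = 0 := hy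
    simp [this]
  obtain ⟨h, hh⟩ := Module.projective_lifting_property (f.comp X.subtype) f hXs
  let g : Module.End R Q := X.subtype.comp h
  have hg : ∀ q, f (g q) = f q := fun q => LinearMap.congr_fun hh q
  have hgk : ∀ k q, f ((g ^ k) q) = f q := by
    intro k
    induction k with
    | zero => intro q; simp
    | succ k ih => intro q; rw [pow_succ', Module.End.mul_apply, hg, ih]
  obtain ⟨k, hk0, hk⟩ : ∃ k, 0 < k ∧ IsCompl (LinearMap.ker (g ^ k)) (LinearMap.range (g ^ k)) := by
    obtain ⟨N, hN⟩ := Filter.eventually_atTop.1 (LinearMap.eventually_isCompl_ker_pow_range_pow g)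
    exact ⟨N + 1, by omega, hN _ (by omega)⟩
  let Y : Submodule R Q := LinearMap.range (g ^ k)
  have hYX : Y ≤ X := by
    rintro _ ⟨q, rfl⟩
    obtain ⟨j, rfl⟩ : ∃ j, k = j + 1 := ⟨k - 1, by omega⟩
    rw [pow_succ', Module.End.mul_apply]
    exact (h _).2
  have hYp : Module.Projective R Y := by
    refine Module.Projective.of_split Y.subtype (Y.projectionOnto _ hk.symm) ?_
    ext y
    simp
  have hYtop : Y = ⊤ := by
    let Z : Submodule R (Fin n → R) := Y.map Q.subtype
    have hZQ : Z ≤ Q := Submodule.map_subtype_le Q Y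
    have hZ : Z ∈ S := by
      refine ⟨Module.Projective.of_equiv (Y.equivMapOfInjective Q.subtype Q.injective_subtype), ?_⟩
      intro m
      obtain ⟨q, hq⟩ := hQs m
      exact ⟨⟨((g ^ k) q : Q), ⟨_, ⟨q, rfl⟩, rfl⟩⟩, (hgk k q).trans hq⟩
    have hZeq : Z = Q := by
      by_contra hne
      exact hmin Z hZ (lt_of_le_of_ne hZQ hne)
    refine eq_top_iff.2 fun q _ => ?_
    have : (q : Fin n → R) ∈ Z := by rw [hZeq]; exact q.2
    obtain ⟨y, hy, hyq⟩ := this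
    rwa [← Q.injective_subtype hyq]
  exact top_le_iff.1 (hYtop ▸ hYX)

theorem exists_isInjectiveEnvelope (M : ModuleCat.{u} R) :
    ∃ (E : ModuleCat.{u} R) (i : M →ₗ[R] E), IsInjectiveEnvelope i := by
  obtain ⟨E, i, hEinj, hi⟩ : ∃ (E : ModuleCat.{u} R) (i : M ⟶ E),
      Module.Injective R E ∧ CategoryTheory.Mono i := by
    obtain ⟨p⟩ := CategoryTheory.EnoughInjectives.presentation M
    have := p.injective
    exact ⟨p.J, p.f, Module.injective_module_of_injective_object R p.J, p.mono⟩
  have hi' : Function.Injective i.hom := (ModuleCat.mono_iff_injective i).1 hi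
  let N : Submodule R E := LinearMap.range i.hom
  let S : Set (Submodule R E) :=
    {X | N ≤ X ∧ ∀ x ∈ X, x ≠ 0 → ∃ r : R, r • x ∈ N ∧ r • x ≠ 0}
  have hNS : N ∈ S := ⟨le_rfl, fun x hx h0 => ⟨1, by simpa using hx, by simpa using h0⟩⟩
  obtain ⟨X, -, hX⟩ := zorn_le_nonempty₀ S (by
    intro c hcS hc Y hY
    refine ⟨sSup c, ⟨(hcS hY).1.trans (le_sSup hY), ?_⟩, fun z hz => le_sSup hz⟩
    intro x hx h0
    obtain ⟨Z, hZ, hxZ⟩ := (Submodule.mem_sSup_of_directed ⟨Y, hY⟩ hc.directedOn).1 hx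
    exact (hcS hZ).2 x hxZ h0) N hNS
  have hXS : X ∈ S := hX.prop
  obtain ⟨Y, -, hY⟩ := zorn_le_nonempty₀ {Y : Submodule R E | Disjoint Y X} (by
    intro c hcS hc Y hY
    refine ⟨sSup c, ?_, fun z hz => le_sSup hz⟩
    refine Submodule.disjoint_def.2 fun x hx hxX => ?_
    obtain ⟨Z, hZ, hxZ⟩ := (Submodule.mem_sSup_of_directed ⟨Y, hY⟩ hc.directedOn).1 hx
    exact Submodule.disjoint_def.1 (hcS hZ) x hxZ hxX) ⊥ disjoint_bot_left
  have hYX : Disjoint Y X := hY.prop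
  have hinj : Function.Injective (Y.mkQ.comp X.subtype) := by
    rw [← LinearMap.ker_eq_bot, LinearMap.ker_eq_bot']
    intro x hx
    have : (x : E) ∈ Y := by simpa using hx
    exact Subtype.ext (Submodule.disjoint_def.1 hYX _ this x.2)
  obtain ⟨g, hg⟩ := Module.Injective.extension_property R E _ _ _ hinj X.subtype
  have hgx : ∀ x (hx : x ∈ X), g (Y.mkQ x) = x := fun x hx => LinearMap.congr_fun hg ⟨x, hx⟩
  let r : E →ₗ[R] E := g.comp Y.mkQ
  have hrX : LinearMap.range r = X := by
    refine (hX.eq_of_le ?_ ?_).symm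
    · refine ⟨fun x hx => ⟨x, hgx x (hXS.1 hx)⟩, ?_⟩
      rintro _ ⟨e, rfl⟩ h0
      have heY : e ∉ Y := by
        intro he
        apply h0
        change g (Y.mkQ e) = 0
        rw [(Submodule.Quotient.mk_eq_zero Y).2 he |> fun h => (h : Y.mkQ e = 0), map_zero]
      have hnd : ¬ Disjoint (Y ⊔ Submodule.span R {e}) X := by
        intro hd
        have := hY.eq_of_le hd le_sup_left
        exact heY (this ▸ (Submodule.mem_sup_right (Submodule.mem_span_singleton_self e)))
      rw [Submodule.disjoint_def] at hnd
      push Not at hnd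
      obtain ⟨x, hx, hxX, hx0⟩ := hnd
      obtain ⟨y, hy, z, hz, rfl⟩ := Submodule.mem_sup.1 hx
      obtain ⟨a, rfl⟩ := Submodule.mem_span_singleton.1 hz
      have hq : Y.mkQ (y + a • e) = a • Y.mkQ e := by
        rw [map_add, map_smul, (Submodule.Quotient.mk_eq_zero Y).2 hy |> fun h => (h : Y.mkQ y = 0),
          zero_add]
      have hrr : a • r e = y + a • e := by
        rw [← hgx _ hxX, hq, map_smul]; rfl
      obtain ⟨b, hb, hb0⟩ := hXS.2 _ hxX hx0
      refine ⟨b * a, ?_, ?_⟩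
      · rw [mul_smul, hrr]; exact hb
      · rw [mul_smul, hrr]; exact hb0
    · intro x hx
      exact ⟨x, hgx x hx⟩
  let r' : E →ₗ[R] X := r.codRestrict X (fun e => hrX ▸ ⟨e, rfl⟩)
  have hr' : ∀ x : X, r' x = x := fun x => Subtype.ext (hgx x x.2)
  have hNX : ∀ m, i.hom m ∈ X := fun m => hXS.1 ⟨m, rfl⟩
  refine ⟨ModuleCat.of R X, i.hom.codRestrict X hNX, ⟨⟨?_⟩, ?_, ?_⟩⟩
  · intro A B _ _ _ _ f hf φ
    obtain ⟨h, hh⟩ := Module.Injective.extension_property R E _ _ f hf (X.subtype.comp φ)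
    refine ⟨r'.comp h, fun a => ?_⟩
    have := LinearMap.congr_fun hh a
    simp only [LinearMap.comp_apply] at this ⊢
    rw [this]
    exact hr' _
  · intro a b hab
    exact hi' (congrArg Subtype.val hab)
  · change ∀ Z : Submodule R X, Z ⊓ LinearMap.range (i.hom.codRestrict X hNX) = ⊥ → Z = ⊥
    intro Z hZ
    refine (Submodule.eq_bot_iff _).2 fun z hz => ?_
    by_contra h0
    obtain ⟨a, ⟨m, hm⟩, ha0⟩ := hXS.2 z z.2 (fun h => h0 (Subtype.ext h))
    have : a • z ∈ Z ⊓ LinearMap.range (i.hom.codRestrict X hNX) :=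
      ⟨Z.smul_mem a hz, ⟨m, Subtype.ext hm⟩⟩
    rw [hZ] at this
    exact ha0 (congrArg Subtype.val ((Submodule.mem_bot R).1 this))

section Syzygy

variable [IsArtinianRing R]

/-- The source of a chosen projective cover of `M`. -/
noncomputable def coverModule (M : FGModuleCat.{u} R) : FGModuleCat.{u} R :=
  (exists_isProjectiveCover M).choose

/-- A chosen projective cover of `M`. -/
noncomputable def cover (M : FGModuleCat.{u} R) : coverModule M →ₗ[R] M :=
  (exists_isProjectiveCover M).choose_spec.choose

theorem isProjectiveCover_cover (M : FGModuleCat.{u} R) : IsProjectiveCover (cover M) :=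
  (exists_isProjectiveCover M).choose_spec.choose_spec

/-- The syzygy `Ω M`: the kernel of a projective cover of `M`. -/
noncomputable def syzygy (M : FGModuleCat.{u} R) : FGModuleCat.{u} R :=
  FGModuleCat.of R (LinearMap.ker (cover M))

end Syzygy

/-- The target of a chosen injective envelope of `M`. -/
noncomputable def envelopeModule (M : ModuleCat.{u} R) : ModuleCat.{u} R :=
  (exists_isInjectiveEnvelope M).choose

/-- A chosen injective envelope of `M`. -/
noncomputable def envelope (M : ModuleCat.{u} R) : M →ₗ[R] envelopeModule M :=
  (exists_isInjectiveEnvelope M).choose_spec.choose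

theorem isInjectiveEnvelope_envelope (M : ModuleCat.{u} R) : IsInjectiveEnvelope (envelope M) :=
  (exists_isInjectiveEnvelope M).choose_spec.choose_spec

/-- The cosyzygy `Ω⁻¹ M`: the cokernel of an injective envelope of `M`. -/
noncomputable def cosyzygy (M : ModuleCat.{u} R) : ModuleCat.{u} R :=
  ModuleCat.of R (envelopeModule M ⧸ LinearMap.range (envelope M))

end Modules

/-! ### The group `K₀` and the Igusa-Todorov function -/

section Phi

variable (R : Type u) [Ring R]

/-- The relations of `K₀`: `[M] - [M'] - [M'']` whenever `M ≅ M' ⊕ M''`, and `[P]` for `P`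
projective. (With `M'' = 0` they identify the symbols of isomorphic modules.) -/
def K0Relations : Set (FreeAbelianGroup (FGModuleCat.{u} R)) :=
  {x | ∃ M M' M'' : FGModuleCat.{u} R, Nonempty (M ≃ₗ[R] M' × M'') ∧
      x = FreeAbelianGroup.of M - FreeAbelianGroup.of M' - FreeAbelianGroup.of M''} ∪
    {x | ∃ P : FGModuleCat.{u} R, Module.Projective R P ∧ x = FreeAbelianGroup.of P}

/-- The free abelian group on the finitely generated modules, modulo `K0Relations`. -/
abbrev K0 : Type (u + 1) :=
  FreeAbelianGroup (FGModuleCat.{u} R) ⧸ AddSubgroup.closure (K0Relations R)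

variable {R}

/-- The class `[M]` of `M` in `K₀`. -/
def cls (M : FGModuleCat.{u} R) : K0 R :=
  QuotientAddGroup.mk (FreeAbelianGroup.of M)

theorem cls_of_equiv_prod {M M' M'' : FGModuleCat.{u} R} (e : M ≃ₗ[R] M' × M'') :
    cls M = cls M' + cls M'' := by
  have h : ((FreeAbelianGroup.of M - FreeAbelianGroup.of M' - FreeAbelianGroup.of M'' :
      FreeAbelianGroup (FGModuleCat.{u} R)) : K0 R) = 0 :=
    (QuotientAddGroup.eq_zero_iff _).2
      (AddSubgroup.subset_closure (Or.inl ⟨M, M', M'', ⟨e⟩, rfl⟩))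
  have h' : cls M - cls M' - cls M'' = 0 := h
  rw [sub_sub, sub_eq_zero] at h'
  exact h'

theorem cls_of_projective (P : FGModuleCat.{u} R) (hP : Module.Projective R P) : cls P = 0 :=
  (QuotientAddGroup.eq_zero_iff _).2 (AddSubgroup.subset_closure (Or.inr ⟨P, hP, rfl⟩))

theorem exists_schanuel_equiv {P P' M : Type*} [AddCommGroup P] [AddCommGroup P'] [AddCommGroup M]
    [Module R P] [Module R P'] [Module R M] [Module.Projective R P] [Module.Projective R P']
    (f : P →ₗ[R] M) (g : P' →ₗ[R] M) (hf : Function.Surjective f) (hg : Function.Surjective g) :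
    Nonempty ((LinearMap.ker f × P') ≃ₗ[R] (LinearMap.ker g × P)) := by
  obtain ⟨a, ha⟩ := Module.projective_lifting_property g f hg
  obtain ⟨b, hb⟩ := Module.projective_lifting_property f g hf
  have ha' : ∀ x, g (a x) = f x := fun x => LinearMap.congr_fun ha x
  have hb' : ∀ x, f (b x) = g x := fun x => LinearMap.congr_fun hb x
  exact ⟨{
    toFun := fun z => (⟨z.2 + a (z.1 - b z.2), by
      have h1 : f z.1 = 0 := z.1.2
      simp [ha', hb', h1]⟩, z.1 - b z.2)
    invFun := fun z => (⟨z.2 + b (z.1 - a z.2), by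
      have h1 : g z.1 = 0 := z.1.2
      simp [ha', hb', h1]⟩, z.1 - a z.2)
    map_add' := fun x y => by ext <;> simp <;> abel
    map_smul' := fun c x => by ext <;> simp [smul_sub, smul_add]
    left_inv := fun z => by ext <;> simp
    right_inv := fun z => by ext <;> simp }⟩

variable [IsArtinianRing R]

theorem cls_ker_eq_cls_syzygy {M P : FGModuleCat.{u} R} (hP : Module.Projective R P)
    (f : P →ₗ[R] M) (hf : Function.Surjective f) :
    cls (FGModuleCat.of R (LinearMap.ker f)) = cls (syzygy M) := by
  have hc := isProjectiveCover_cover M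
  have := hc.projective
  obtain ⟨e⟩ := exists_schanuel_equiv f (cover M) hf hc.surjective
  have h1 : cls (FGModuleCat.of R (LinearMap.ker f × coverModule M)) =
      cls (FGModuleCat.of R (LinearMap.ker f)) + cls (coverModule M) :=
    cls_of_equiv_prod (LinearEquiv.refl R (LinearMap.ker f × coverModule M))
  have h2 : cls (FGModuleCat.of R (LinearMap.ker f × coverModule M)) = cls (syzygy M) + cls P :=
    cls_of_equiv_prod e
  rw [cls_of_projective _ hc.projective, add_zero] at h1
  rw [cls_of_projective _ hP, add_zero] at h2
  exact h1.symm.trans h2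

theorem K0Relations_le_ker : AddSubgroup.closure (K0Relations R) ≤
    (FreeAbelianGroup.lift fun M : FGModuleCat.{u} R => cls (syzygy M)).ker := by
  rw [AddSubgroup.closure_le]
  rintro x (⟨M, M', M'', ⟨e⟩, rfl⟩ | ⟨P, hP, rfl⟩)
  · have h' := isProjectiveCover_cover M'
    have h'' := isProjectiveCover_cover M''
    have := h'.projective
    have := h''.projective
    let p : (coverModule M' × coverModule M'') →ₗ[R] M :=
      e.symm.toLinearMap.comp ((cover M').prodMap (cover M''))
    have hp : Function.Surjective p :=
      e.symm.surjective.comp (Prod.map_surjective.2 ⟨h'.surjective, h''.surjective⟩)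
    have hmem : ∀ z, z ∈ LinearMap.ker p ↔ cover M' z.1 = 0 ∧ cover M'' z.2 = 0 := by
      intro z
      simp [p]
    let k : LinearMap.ker p ≃ₗ[R] LinearMap.ker (cover M') × LinearMap.ker (cover M'') :=
      { toFun := fun z => (⟨z.1.1, ((hmem _).1 z.2).1⟩, ⟨z.1.2, ((hmem _).1 z.2).2⟩)
        invFun := fun z => ⟨(z.1.1, z.2.1), (hmem _).2 ⟨z.1.2, z.2.2⟩⟩
        map_add' := fun _ _ => rfl
        map_smul' := fun _ _ => rfl
        left_inv := fun _ => rfl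
        right_inv := fun _ => rfl }
    have h1 := cls_ker_eq_cls_syzygy (M := M)
      (P := FGModuleCat.of R (coverModule M' × coverModule M''))
      (inferInstanceAs (Module.Projective R (coverModule M' × coverModule M''))) p hp
    have h2 : cls (FGModuleCat.of R (LinearMap.ker p)) = cls (syzygy M') + cls (syzygy M'') :=
      cls_of_equiv_prod k
    simp [← h1, h2]
  · have h1 := cls_ker_eq_cls_syzygy (M := P) hP LinearMap.id Function.surjective_id
    have h2 : Module.Projective R (LinearMap.ker (LinearMap.id : P →ₗ[R] P)) := by
      rw [LinearMap.ker_id]; infer_instance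
    have h3 := cls_of_projective (FGModuleCat.of R (LinearMap.ker (LinearMap.id : P →ₗ[R] P))) h2
    change FreeAbelianGroup.lift _ (FreeAbelianGroup.of P) = 0
    rw [FreeAbelianGroup.lift_apply_of, ← h1]
    exact h3

variable (R) in
/-- The endomorphism of `K₀` induced by `Ω`, that is, `[M] ↦ [Ω M]`. -/
noncomputable def omegaBar : K0 R →+ K0 R :=
  QuotientAddGroup.lift _ (FreeAbelianGroup.lift fun M : FGModuleCat.{u} R => cls (syzygy M))
    K0Relations_le_ker

/-- `⟨add M⟩`: the subgroup of `K₀` generated by the classes of the indecomposable direct summands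
of `M`. -/
def addClosure (M : FGModuleCat.{u} R) : AddSubgroup (K0 R) :=
  AddSubgroup.closure {x | ∃ N N' : FGModuleCat.{u} R, IsIndecomposable R N ∧
    Nonempty (M ≃ₗ[R] N × N') ∧ x = cls N}

/-- The image of `⟨add M⟩` under the `l`-th power of `omegaBar`. -/
noncomputable def omegaBarPow (M : FGModuleCat.{u} R) : ℕ → AddSubgroup (K0 R)
  | 0 => addClosure M
  | l + 1 => (omegaBarPow M l).map (omegaBar R)

/-- The Igusa-Todorov function: the least `l` such that `omegaBar` is injective on the image of
`⟨add M⟩` under the `(l + s)`-th power of `omegaBar`, for all `s`. (It is `⊤` only if there is no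
such `l`.) -/
noncomputable def phi (M : FGModuleCat.{u} R) : ℕ∞ :=
  ⨅ l ∈ {l : ℕ | ∀ s : ℕ, Set.InjOn (omegaBar R) (omegaBarPow M (l + s))}, (l : ℕ∞)

variable (R) in
/-- The `φ`-dimension: the supremum of `phi M` over the finitely generated modules `M`. -/
noncomputable def phiDim : ℕ∞ :=
  ⨆ M : FGModuleCat.{u} R, phi M

end Phi

/-! ### The path algebra of a quiver and its radical square zero quotient

Paths are composed from left to right, so that the right module `e_i A` has as basis the paths
starting at `i`. -/

section PathAlgebra

variable (K : Type*) [Field K] (V : Type*) [Quiver V]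

/-- All paths of the quiver `V`, with their source and target. -/
abbrev AnyPath : Type _ := Σ i j : V, Quiver.Path i j

/-- The path algebra of the quiver `V` over `K`: the vector space with basis the paths of `V`. -/
def PathAlgebra : Type _ := AnyPath V →₀ K

noncomputable instance : AddCommGroup (PathAlgebra K V) :=
  inferInstanceAs (AddCommGroup (AnyPath V →₀ K))

noncomputable instance : Module K (PathAlgebra K V) :=
  inferInstanceAs (Module K (AnyPath V →₀ K))

variable {V} in
/-- The basis element of the path algebra given by a path. -/
noncomputable def ofPath {i j : V} (p : Quiver.Path i j) : PathAlgebra K V :=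
  Finsupp.single (⟨i, j, p⟩ : AnyPath V) (1 : K)

open Classical in
variable {V} in
/-- The product of two basis elements: the concatenation of the paths if the first one ends where
the second one starts, and `0` otherwise. -/
noncomputable def pathMul (p q : AnyPath V) : PathAlgebra K V :=
  if h : q.1 = p.2.1 then ofPath K (p.2.2.comp (q.2.2.cast h rfl)) else 0

/-- Multiplication in the path algebra: the bilinear extension of `pathMul`. -/
noncomputable def mulBilin : PathAlgebra K V →ₗ[K] PathAlgebra K V →ₗ[K] PathAlgebra K V :=
  Finsupp.lift (PathAlgebra K V →ₗ[K] PathAlgebra K V) K (AnyPath V)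
    (fun p => Finsupp.lift (PathAlgebra K V) K (AnyPath V) (fun q => pathMul K p q))

variable {V}

theorem mulBilin_ofPath {i j k l : V} (p : Quiver.Path i j) (q : Quiver.Path k l) :
    mulBilin K V (ofPath K p) (ofPath K q) = pathMul K ⟨i, j, p⟩ ⟨k, l, q⟩ := by
  have h : ∀ (N : Type _) [AddCommGroup N] [Module K N] (F : AnyPath V → N) (s : AnyPath V),
      Finsupp.lift N K (AnyPath V) F (Finsupp.single s 1) = F s := by
    intro N _ _ F s
    simp
  unfold mulBilin ofPath
  exact (LinearMap.congr_fun (h _ _ _) _).trans (h _ _ _)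

theorem pathMul_comp {i j k : V} (p : Quiver.Path i j) (q : Quiver.Path j k) :
    pathMul K ⟨i, j, p⟩ ⟨j, k, q⟩ = ofPath K (p.comp q) := by
  simp [pathMul]

theorem pathMul_of_ne {i j k l : V} (p : Quiver.Path i j) (q : Quiver.Path k l) (h : k ≠ j) :
    pathMul K ⟨i, j, p⟩ ⟨k, l, q⟩ = 0 := by
  simp [pathMul, h]

variable {K} in
theorem pathAlgebra_induction {P : PathAlgebra K V → Prop} (x : PathAlgebra K V) (h0 : P 0)
    (hadd : ∀ x y, P x → P y → P (x + y))
    (hsmul : ∀ (c : K) (i j : V) (p : Quiver.Path i j), P (c • ofPath K p)) : P x := by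
  refine Finsupp.induction_linear (motive := P) x h0 (fun x y => hadd x y) ?_
  rintro ⟨i, j, p⟩ c
  have h := hsmul c i j p
  have h2 : c • ofPath K p = (Finsupp.single (⟨i, j, p⟩ : AnyPath V) c : AnyPath V →₀ K) := by
    unfold ofPath
    exact (Finsupp.smul_single c _ (1 : K)).trans (by simp)
  rwa [h2] at h

theorem mulBilin_assoc (x y z : PathAlgebra K V) :
    mulBilin K V (mulBilin K V x y) z = mulBilin K V x (mulBilin K V y z) := by
  induction x using pathAlgebra_induction with
  | h0 => simp
  | hadd x x' h h' => simp [h, h']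
  | hsmul a i j p =>
    induction y using pathAlgebra_induction with
    | h0 => simp
    | hadd y y' h h' => simp only [map_add, LinearMap.add_apply, h, h']
    | hsmul b k l q =>
      induction z using pathAlgebra_induction with
      | h0 => simp
      | hadd z z' h h' => simp only [map_add, h, h']
      | hsmul c m n r =>
        simp only [map_smul, LinearMap.smul_apply, mulBilin_ofPath]
        congr 1
        congr 2
        by_cases h1 : k = j
        · subst h1
          rw [pathMul_comp, mulBilin_ofPath]
          by_cases h2 : m = l
          · subst h2
            rw [pathMul_comp, pathMul_comp, mulBilin_ofPath, pathMul_comp, Quiver.Path.comp_assoc]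
          · rw [pathMul_of_ne K _ _ h2, pathMul_of_ne K _ _ h2, map_zero]
        · rw [pathMul_of_ne K _ _ h1, map_zero, LinearMap.zero_apply]
          by_cases h2 : m = l
          · subst h2
            rw [pathMul_comp, mulBilin_ofPath, pathMul_of_ne K _ _ h1]
          · rw [pathMul_of_ne K _ _ h2, map_zero]

variable [Fintype V]

variable (V) in
/-- The unit of the path algebra: the sum of the trivial paths. -/
noncomputable def pathOne : PathAlgebra K V := ∑ i : V, ofPath K (Quiver.Path.nil : Quiver.Path i i)

theorem one_mulBilin (x : PathAlgebra K V) : mulBilin K V (pathOne K V) x = x := by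
  induction x using pathAlgebra_induction with
  | h0 => simp
  | hadd x y h h' => rw [map_add, h, h']
  | hsmul c i j p =>
    rw [map_smul, pathOne, map_sum, LinearMap.sum_apply, Finset.sum_eq_single i]
    · rw [mulBilin_ofPath, pathMul_comp, Quiver.Path.nil_comp]
    · intro k _ hk
      rw [mulBilin_ofPath, pathMul_of_ne K _ _ hk.symm]
    · simp

theorem mulBilin_one (x : PathAlgebra K V) : mulBilin K V x (pathOne K V) = x := by
  induction x using pathAlgebra_induction with
  | h0 => simp
  | hadd x y h h' => rw [map_add, LinearMap.add_apply, h, h']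
  | hsmul c i j p =>
    rw [map_smul, LinearMap.smul_apply, pathOne, map_sum, Finset.sum_eq_single j]
    · rw [mulBilin_ofPath, pathMul_comp, Quiver.Path.comp_nil]
    · intro k _ hk
      rw [mulBilin_ofPath, pathMul_of_ne K _ _ hk]
    · simp

noncomputable instance : Ring (PathAlgebra K V) :=
  { (inferInstance : AddCommGroup (PathAlgebra K V)) with
    mul := fun x y => mulBilin K V x y
    one := pathOne K V
    left_distrib := fun x y z => map_add (mulBilin K V x) y z
    right_distrib := fun x y z => LinearMap.map_add₂ (mulBilin K V) x y z
    zero_mul := fun x => LinearMap.map_zero₂ (mulBilin K V) x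
    mul_zero := fun x => map_zero (mulBilin K V x)
    mul_assoc := mulBilin_assoc K
    one_mul := one_mulBilin K
    mul_one := mulBilin_one K }

theorem pathAlgebra_mul_def (x y : PathAlgebra K V) : x * y = mulBilin K V x y := rfl

noncomputable instance : Algebra K (PathAlgebra K V) :=
  Algebra.ofModule (fun c x y => LinearMap.map_smul₂ (mulBilin K V) c x y)
    (fun c x y => map_smul (mulBilin K V x) c y)

theorem ofPath_mul_ofPath {i j k : V} (p : Quiver.Path i j) (q : Quiver.Path j k) :
    ofPath K p * ofPath K q = ofPath K (p.comp q) :=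
  (mulBilin_ofPath K p q).trans (pathMul_comp K p q)

theorem ofPath_mul_ofPath_of_ne {i j k l : V} (p : Quiver.Path i j) (q : Quiver.Path k l)
    (h : k ≠ j) : ofPath K p * ofPath K q = 0 :=
  (mulBilin_ofPath K p q).trans (pathMul_of_ne K p q h)

variable (V)

/-- The two-sided ideal `J` of the path algebra generated by the arrows. -/
noncomputable def arrowIdeal : Ideal (PathAlgebra K V) :=
  (TwoSidedIdeal.span
    {x : PathAlgebra K V | ∃ (i j : V) (a : i ⟶ j), x = ofPath K a.toPath}).asIdeal

instance : (arrowIdeal K V).IsTwoSided := by unfold arrowIdeal; infer_instance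

/-- The algebra `K V / J²`. -/
abbrev RadSqZeroAlgebra : Type _ := PathAlgebra K V ⧸ (arrowIdeal K V) ^ 2

variable {V} in
theorem ofPath_toPath_mem {i j : V} (a : i ⟶ j) : ofPath K a.toPath ∈ arrowIdeal K V :=
  TwoSidedIdeal.mem_asIdeal.2 (TwoSidedIdeal.subset_span ⟨i, j, a, rfl⟩)

instance finite_radSqZeroAlgebra [∀ i j : V, Finite (i ⟶ j)] :
    Module.Finite K (RadSqZeroAlgebra K V) := by
  let s : Set (RadSqZeroAlgebra K V) :=
    Set.range (fun i : V => Ideal.Quotient.mk (arrowIdeal K V ^ 2)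
      (ofPath K (Quiver.Path.nil : Quiver.Path i i))) ∪
    Set.range (fun a : (Σ i j : V, (i ⟶ j)) => Ideal.Quotient.mk (arrowIdeal K V ^ 2)
      (ofPath K a.2.2.toPath))
  have hs : s.Finite := (Set.finite_range _).union (Set.finite_range _)
  refine ⟨Submodule.fg_def.2 ⟨s, hs, eq_top_iff.2 ?_⟩⟩
  rintro x -
  obtain ⟨x, rfl⟩ := Ideal.Quotient.mk_surjective x
  induction x using pathAlgebra_induction with
  | h0 => rw [map_zero]; exact zero_mem _
  | hadd x y h h' => rw [map_add]; exact add_mem h h'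
  | hsmul c i j p =>
    have hc : Ideal.Quotient.mk (arrowIdeal K V ^ 2) (c • ofPath K p) =
        c • Ideal.Quotient.mk (arrowIdeal K V ^ 2) (ofPath K p) := rfl
    rw [hc]
    refine Submodule.smul_mem _ c ?_
    cases p with
    | nil => exact Submodule.subset_span (Or.inl ⟨i, rfl⟩)
    | cons p a =>
      cases p with
      | nil => exact Submodule.subset_span (Or.inr ⟨⟨_, _, a⟩, rfl⟩)
      | cons p b =>
        have h : ofPath K ((p.cons b).cons a) =
            ofPath K p * ofPath K b.toPath * ofPath K a.toPath := by
          rw [ofPath_mul_ofPath, ofPath_mul_ofPath]; rfl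
        have h2 : ofPath K ((p.cons b).cons a) ∈ arrowIdeal K V ^ 2 := by
          rw [h, Submodule.pow_succ, Submodule.pow_one]
          exact Ideal.mul_mem_mul (Ideal.mul_mem_left _ _ (ofPath_toPath_mem K b))
            (ofPath_toPath_mem K a)
        rw [Ideal.Quotient.eq_zero_iff_mem.2 h2]
        exact zero_mem _

instance isArtinianRing_radSqZeroAlgebra [∀ i j : V, Finite (i ⟶ j)] :
    IsArtinianRing (RadSqZeroAlgebra K V)ᵐᵒᵖ :=
  IsArtinianRing.of_finite K (RadSqZeroAlgebra K V)ᵐᵒᵖ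

variable {V} in
/-- The idempotent `e_i` of `K V / J²`: the class of the trivial path at `i`. -/
noncomputable def idem (i : V) : RadSqZeroAlgebra K V :=
  Ideal.Quotient.mk (arrowIdeal K V ^ 2) (ofPath K (Quiver.Path.nil : Quiver.Path i i))

/-- The projection `K V / J² → K V / J`. -/
noncomputable def toSemisimpleQuotient :
    RadSqZeroAlgebra K V →+* PathAlgebra K V ⧸ arrowIdeal K V :=
  Ideal.Quotient.factor (Ideal.pow_le_self two_ne_zero)

/-- `K V / J` as a right module over `K V / J²`. -/
noncomputable instance : Module (RadSqZeroAlgebra K V)ᵐᵒᵖ (PathAlgebra K V ⧸ arrowIdeal K V) :=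
  Module.compHom (PathAlgebra K V ⧸ arrowIdeal K V) (RingHom.op (toSemisimpleQuotient K V))

theorem op_smul_semisimple (a : RadSqZeroAlgebra K V) (x : PathAlgebra K V ⧸ arrowIdeal K V) :
    MulOpposite.op a • x = x * toSemisimpleQuotient K V a := rfl

instance : Module.Finite (RadSqZeroAlgebra K V)ᵐᵒᵖ (PathAlgebra K V ⧸ arrowIdeal K V) := by
  refine ⟨⟨{1}, eq_top_iff.2 ?_⟩⟩
  rintro x -
  obtain ⟨x, rfl⟩ := Ideal.Quotient.mk_surjective x
  rw [Finset.coe_singleton, Submodule.mem_span_singleton]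
  refine ⟨MulOpposite.op (Ideal.Quotient.mk _ x), ?_⟩
  rw [op_smul_semisimple, one_mul]
  rfl

/-- The right `K V / J²`-module `A₀ = K V / J`. -/
noncomputable def semisimpleModule : FGModuleCat (RadSqZeroAlgebra K V)ᵐᵒᵖ :=
  FGModuleCat.of (RadSqZeroAlgebra K V)ᵐᵒᵖ (PathAlgebra K V ⧸ arrowIdeal K V)

/-- The support of a right `K V / J²`-module `M`: the vertices `i` such that the simple module
`S_i` is a composition factor of `M`, that is, `M e_i ≠ 0`. -/
def moduleSupport (M : Type*) [AddCommGroup M] [Module (RadSqZeroAlgebra K V)ᵐᵒᵖ M] : Set V :=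
  {i | ∃ m : M, MulOpposite.op (idem K i) • m ≠ 0}

variable [∀ i j : V, Finite (i ⟶ j)]

/-- The vertices of the heart: those in the support of both `Ωⁿ A₀` and `Ω⁻ⁿ A₀`, where `n` is the
number of vertices. -/
def heart : Set V :=
  moduleSupport K V (syzygy^[Fintype.card V] (semisimpleModule K V)) ∩
    moduleSupport K V (cosyzygy^[Fintype.card V] (semisimpleModule K V).obj)

/-- The vertices of the member: those that are not in the heart. -/
def member : Set V := (heart K V)ᶜ

/-- `A` (isomorphic to `K V / J²`, `V` with `n` vertices) has maximal `φ`-dimension: its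
`φ`-dimension for right modules is `n` if the member is empty, and `n - 1` if the member is not
empty. -/
def HasMaximalPhiDim (A : Type*) [Ring A] [IsArtinianRing Aᵐᵒᵖ] : Prop :=
  (member K V = ∅ ∧ phiDim Aᵐᵒᵖ = (Fintype.card V : ℕ∞)) ∨
    ((member K V).Nonempty ∧ phiDim Aᵐᵒᵖ = ((Fintype.card V - 1 : ℕ) : ℕ∞))

end PathAlgebra

end IgusaTodorov

/-! Let `n` be the number of vertices. Over an algebra with radical square zero, `Ω M` lies in `rad
P` for a projective cover `P` of `M`. It is therefore semisimple and contains no simple module at a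
source. Simple modules at sinks are projective and vanish in `K₀`, so the image of `omegaBar` lies
in the subgroup spanned by the simples `S_i` with `i` neither a sink nor a source (`omegaBar_mem`).
Multiplicities of these simples as direct summands define homomorphisms on `K₀`
(`exists_multiplicityHom`), so the span is free on them. Its rank is at most `n`, and at most `n -
1` as soon as a sink or a source exists. If there is neither, syzygies and cosyzygies of `A₀` keep
full support and the member is empty (`exists_isSink_or_isSource`). Hence maximality of the
`φ`-dimension `d` gives rank at most `d`.

The rest is linear algebra (`exists_pair`). Write `Ω` for `omegaBar`. If `d = k + 1`, some integral
combination `x` of indecomposables satisfies `Ω^m x ≠ 0` and `Ω^(m+1) x = 0` with `m ≥ k`. For `m >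
0`, the matrix `T` of `Ω` on the span has kernels growing strictly up to `T^m`. As the rank is at
most `m + 1`, `T^m` has rank at most one, and the kernel of `Ω^(m+1)` is the kernel of one integral
functional `f`. If no two indecomposables sufficed, then `Ω^m` would kill every `f(N) N' - f(N') N`.
By linearity this gives `f(N) Ω^m x = f(x) Ω^m N = 0`, and `Ω^m x = 0` by torsion-freeness of the
span, a contradiction; if `f` is zero on all indecomposables, each is already killed by `Ω^m`. The
case `m = 0` needs a separate argument. -/

namespace IgusaTodorov

/-! ### Linear algebra: an endomorphism with image in a free group of small rank -/

section LinearAlgebra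

theorem exists_hom_eq_iterate {G : Type*} [AddCommGroup G] (Ω : G →+ G) (k : ℕ) :
    ∃ Ωk : G →+ G, ∀ y, Ωk y = Ω^[k] y := by
  induction k with
  | zero => exact ⟨AddMonoidHom.id G, fun _ => rfl⟩
  | succ k ih =>
    obtain ⟨Ωk, h⟩ := ih
    exact ⟨Ω.comp Ωk, fun y => by rw [Function.iterate_succ_apply', ← h]; rfl⟩

/-- The kernels of the powers of `T` increase strictly up to exponent `k + 1`: `T ^ (k - j)` sends
`v` into the kernel of `T ^ (j + 1)` but not into that of `T ^ j`. -/
theorem le_finrank_ker_pow {F W : Type*} [Field F] [AddCommGroup W] [Module F W]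
    [FiniteDimensional F W] (T : Module.End F W) (v : W) (k : ℕ) (hv : (T ^ k) v ≠ 0)
    (hv' : (T ^ (k + 1)) v = 0) :
    ∀ j ≤ k + 1, j ≤ Module.finrank F (LinearMap.ker (T ^ j)) := by
  intro j
  induction j with
  | zero => intro _; exact Nat.zero_le _
  | succ j ih =>
    intro hj
    have hlt : LinearMap.ker (T ^ j) < LinearMap.ker (T ^ (j + 1)) := by
      refine lt_of_le_of_ne ?_ ?_
      · intro y hy
        rw [LinearMap.mem_ker] at hy ⊢
        rw [pow_succ', Module.End.mul_apply, hy, map_zero]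
      · intro h
        have h1 : (T ^ (k - j)) v ∈ LinearMap.ker (T ^ (j + 1)) := by
          rw [LinearMap.mem_ker, ← Module.End.mul_apply, ← pow_add,
            show j + 1 + (k - j) = k + 1 by omega]
          exact hv'
        rw [← h, LinearMap.mem_ker, ← Module.End.mul_apply, ← pow_add,
          show j + (k - j) = k by omega] at h1
        exact hv h1
    have := Submodule.finrank_lt_finrank_of_lt hlt
    have := ih (by omega)
    omega

theorem finrank_range_pow_le_one {F W : Type*} [Field F] [AddCommGroup W] [Module F W]
    [FiniteDimensional F W] (T : Module.End F W) (v : W) (k : ℕ) (hv : (T ^ k) v ≠ 0)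
    (hv' : (T ^ (k + 1)) v = 0) (hk : Module.finrank F W ≤ k + 2) :
    Module.finrank F (LinearMap.range (T ^ (k + 1))) ≤ 1 := by
  have h1 := le_finrank_ker_pow T v k hv hv' (k + 1) le_rfl
  have h2 := LinearMap.finrank_range_add_finrank_ker (T ^ (k + 1))
  omega

/-- A subspace of dimension at most one of a coordinate space is either zero or is embedded by
one of the coordinates. -/
theorem exists_coordinate_injOn {F B : Type*} [Field F] [Finite B] (U : Submodule F (B → F))
    (hU : Module.finrank F U ≤ 1) (hU' : U ≠ ⊥) : ∃ b : B, ∀ y ∈ U, y b = 0 → y = 0 := by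
  obtain ⟨w, hw⟩ := finrank_le_one_iff.1 hU
  have hw0 : (w : B → F) ≠ 0 := by
    intro h
    refine hU' ((Submodule.eq_bot_iff _).2 fun y hy => ?_)
    obtain ⟨c, hc⟩ := hw ⟨y, hy⟩
    have := congrArg Subtype.val hc
    simpa [h] using this.symm
  obtain ⟨b, hb⟩ := Function.ne_iff.1 hw0
  refine ⟨b, fun y hy h => ?_⟩
  obtain ⟨c, hc⟩ := hw ⟨y, hy⟩
  have hc' : c • (w : B → F) = y := congrArg Subtype.val hc
  rw [← hc'] at h ⊢
  have : c = 0 := by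
    rcases mul_eq_zero.1 (h : c * (w : B → F) b = 0) with h | h
    · exact h
    · exact absurd h hb
  rw [this, zero_smul]

variable {G : Type*} [AddCommGroup G] {B : Type*} [Fintype B] [DecidableEq B]

theorem eq_sum_of_mem_closure (s : B → G) (ν : G →+ (B → ℤ)) (hν : ∀ i, ν (s i) = Pi.single i 1)
    {y : G} (hy : y ∈ AddSubgroup.closure (Set.range s)) : y = ∑ i, ν y i • s i := by
  induction hy using AddSubgroup.closure_induction with
  | mem x hx =>
    obtain ⟨i, rfl⟩ := hx
    rw [hν, Finset.sum_eq_single i]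
    · simp
    · intro j _ hj; simp [hj]
    · simp
  | zero => simp
  | add x y _ _ hx hy =>
    rw [map_add]
    simp only [Pi.add_apply, add_smul, Finset.sum_add_distrib]
    rw [← hx, ← hy]
  | neg x _ hx =>
    rw [map_neg]
    simp only [Pi.neg_apply, neg_smul, Finset.sum_neg_distrib]
    rw [← hx]

/-- If the image of `Ω` has a basis `s` with at most `k + 2` elements and `Ω ^ (k + 1)` is neither
zero nor injective on the image of `Ω ^ k`, then the kernel of `Ω ^ (k + 2)` is the kernel of an
integral functional. -/
theorem exists_functional (Ω : G →+ G) (s : B → G) (ν : G →+ (B → ℤ))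
    (hν : ∀ i, ν (s i) = Pi.single i 1) (hΩ : ∀ x, Ω x ∈ AddSubgroup.closure (Set.range s))
    (k : ℕ) (hB : Fintype.card B ≤ k + 2) {x : G} (hx : Ω^[k + 1] x ≠ 0)
    (hx' : Ω^[k + 2] x = 0) : ∃ f : G →+ ℤ, ∀ y, f y = 0 ↔ Ω^[k + 2] y = 0 := by
  -- `T` is the matrix of `Ω` on the span of `s`, with rational coefficients, and `c` takes rational
  -- coordinates; `c` is injective on the span.
  let T : Module.End ℚ (B → ℚ) :=
    ∑ i, (LinearMap.proj i : (B → ℚ) →ₗ[ℚ] ℚ).smulRight (fun j => (ν (Ω (s i)) j : ℚ))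
  let c : G →+ (B → ℚ) :=
    { toFun := fun x j => (ν x j : ℚ)
      map_zero' := by ext; simp
      map_add' := fun x y => by ext; simp }
  have hc : ∀ y ∈ AddSubgroup.closure (Set.range s), c y = 0 → y = 0 := by
    intro y hy h
    rw [eq_sum_of_mem_closure s ν hν hy]
    refine Finset.sum_eq_zero fun i _ => ?_
    have : (ν y i : ℚ) = 0 := congrFun h i
    rw [Int.cast_eq_zero.1 this, zero_smul]
  have hcT : ∀ y ∈ AddSubgroup.closure (Set.range s), c (Ω y) = T (c y) := by
    intro y hy
    conv_lhs => rw [eq_sum_of_mem_closure s ν hν hy]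
    ext j
    simp [T, c, map_sum, LinearMap.sum_apply, Finset.sum_apply]
  have hmem : ∀ m y, Ω^[m + 1] y ∈ AddSubgroup.closure (Set.range s) := by
    intro m y
    rw [Function.iterate_succ_apply']
    exact hΩ _
  -- The first application of `Ω` is spent on entering the span, where `T` takes over. Thus `Ω ^ (k
  -- + 2)` corresponds to `T ^ (k + 1)`, which has rank at most one.
  have hpow : ∀ m y, c (Ω^[m + 1] y) = (T ^ m) (c (Ω y)) := by
    intro m y
    induction m with
    | zero => simp
    | succ m ih =>
      rw [Function.iterate_succ_apply', hcT _ (hmem m y), ih, pow_succ', Module.End.mul_apply]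
  have h1 := finrank_range_pow_le_one T (c (Ω x)) k
    (fun h => hx (hc _ (hmem _ _) (by rw [hpow, h])))
    (by rw [← hpow, hx', map_zero]) (by simpa using hB)
  obtain ⟨Ωk, hΩk⟩ := exists_hom_eq_iterate Ω (k + 2)
  by_cases hbot : LinearMap.range (T ^ (k + 1)) = ⊥
  · refine ⟨0, fun y => ⟨fun _ => hc _ (hmem _ _) ?_, fun _ => rfl⟩⟩
    rw [hpow, LinearMap.range_eq_bot.1 hbot]
    rfl
  -- A single coordinate detects the line `range (T ^ (k + 1))`, so the `b`-th coordinate of `Ω ^ (k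
  -- + 2)` is the required functional.
  · obtain ⟨b, hb⟩ := exists_coordinate_injOn _ h1 hbot
    refine ⟨((Pi.evalAddMonoidHom (fun _ : B => ℤ) b).comp ν).comp Ωk, fun y => ?_⟩
    change ν (Ωk y) b = 0 ↔ _
    rw [hΩk]
    refine ⟨fun h => hc _ (hmem _ _) (hb _ ?_ ?_), fun h => by rw [h]; simp⟩
    · rw [hpow]; exact ⟨_, rfl⟩
    · exact Int.cast_eq_zero.2 h

theorem exists_pair_aux (Ω : G →+ G) (s : B → G) (ν : G →+ (B → ℤ))
    (hν : ∀ i, ν (s i) = Pi.single i 1) (hΩ : ∀ x, Ω x ∈ AddSubgroup.closure (Set.range s))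
    (I : Set G) (hs : ∀ i, s i ∈ I) (k : ℕ) (hB : Fintype.card B ≤ k + 1) {x : G}
    (hxI : x ∈ AddSubgroup.closure I) (hx : Ω^[k] x ≠ 0) (hx' : Ω^[k + 1] x = 0) :
    ∃ N₁ ∈ I, ∃ N₂ ∈ I, ∃ a b : ℤ,
      Ω^[k] (a • N₁ + b • N₂) ≠ 0 ∧ Ω^[k + 1] (a • N₁ + b • N₂) = 0 := by
  by_contra! hcon
  replace hcon : ∀ N₁ ∈ I, ∀ N₂ ∈ I, ∀ a b : ℤ, Ω^[k + 1] (a • N₁ + b • N₂) = 0 →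
      Ω^[k] (a • N₁ + b • N₂) = 0 := by
    intro N₁ h₁ N₂ h₂ a b h
    by_contra h'
    exact hcon N₁ h₁ N₂ h₂ a b h' h
  have hsingle : ∀ N ∈ I, Ω^[k + 1] N = 0 → Ω^[k] N = 0 := by
    intro N hN h
    have := hcon N hN N hN 1 0
    simpa [h] using this
  -- The exponent `0` is separate: `Ω ^ 0` is the identity, and `G` itself is not known to be
  -- torsion-free, only the span of `s` is.
  cases k with
  | zero =>
    simp only [Function.iterate_zero, id_eq, zero_add, Function.iterate_one]
      at hB hx hx' hcon hsingle
    rcases isEmpty_or_nonempty B with hB0 | ⟨⟨j⟩⟩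
    · have h0 : ∀ y, Ω y = 0 := by
        intro y
        have := hΩ y
        rwa [Set.range_eq_empty, AddSubgroup.closure_empty, AddSubgroup.mem_bot] at this
      have : AddSubgroup.closure I ≤ ⊥ := by
        rw [AddSubgroup.closure_le]
        intro N hN
        exact hsingle N hN (h0 N)
      exact hx (this hxI)
    · have : Subsingleton B := Fintype.card_le_one_iff_subsingleton.1 hB
      have hsum : ∀ y, Ω y = ν (Ω y) j • s j := by
        intro y
        conv_lhs => rw [eq_sum_of_mem_closure s ν hν (hΩ y)]
        exact Fintype.sum_subsingleton _ j
      have hsj : s j ≠ 0 := by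
        intro h
        have := congrFun (hν j) j
        simp [h] at this
      have hνj : ν (s j) j = 1 := by rw [hν]; simp
      have hk0 : ν (Ω (s j)) j ≠ 0 := by
        intro h
        refine hsj (hsingle _ (hs j) ?_)
        rw [hsum, h, zero_smul]
      -- With a one-element basis, a combination of `N` and `s j` is killed by `Ω`, hence is zero by
      -- `hcon`. Reading its coordinate shows that `N - ν N j • s j` is killed by `Ω` too, hence
      -- also zero. This uses `s j ∈ I`.
      have hN : ∀ N ∈ I, N = ν N j • s j := by
        intro N hN
        have h1 : ν (Ω (s j)) j • N + (-ν (Ω N) j) • s j = 0 := by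
          refine hcon N hN (s j) (hs j) _ _ ?_
          rw [map_add, map_zsmul, map_zsmul, hsum N, hsum (s j), smul_smul, smul_smul,
            ← add_smul]
          simp only [map_zsmul, Pi.smul_apply, hνj, smul_eq_mul, mul_one]
          rw [mul_comm, neg_mul, mul_comm, add_neg_cancel, zero_smul]
        have h2 : ν (Ω (s j)) j * ν N j = ν (Ω N) j := by
          have := congrFun (congrArg ν h1) j
          simp only [map_add, map_zsmul, Pi.add_apply, Pi.smul_apply, hνj, map_zero,
            Pi.zero_apply, smul_eq_mul] at this
          linarith
        have h3 := hcon N hN (s j) (hs j) 1 (-ν N j) (by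
          rw [map_add, map_zsmul, map_zsmul, hsum N, hsum (s j), smul_smul, smul_smul,
            ← add_smul, ← h2]
          rw [show 1 * (ν (Ω (s j)) j * ν N j) + -ν N j * ν (Ω (s j)) j = 0 by ring, zero_smul])
        rw [one_smul, neg_smul, add_neg_eq_zero] at h3
        exact h3
      have hle : AddSubgroup.closure I ≤ AddSubgroup.zmultiples (s j) := by
        rw [AddSubgroup.closure_le]
        intro N hNI
        exact ⟨ν N j, (hN N hNI).symm⟩
      obtain ⟨m, rfl⟩ := hle hxI
      have h4 : m * ν (Ω (s j)) j = 0 := by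
        have := congrFun (congrArg ν hx') j
        simpa using this
      rcases mul_eq_zero.1 h4 with h | h
      · exact hx (by simp [h])
      · exact hk0 h
  | succ k =>
    obtain ⟨f, hf⟩ := exists_functional Ω s ν hν hΩ k hB hx hx'
    -- Values of `Ω ^ (k + 1)` lie in the span of `s`, which is torsion-free.
    have htf : ∀ (m : ℤ) y, m ≠ 0 → m • Ω^[k + 1] y = 0 → Ω^[k + 1] y = 0 := by
      intro m y hm h
      have hy : Ω^[k + 1] y ∈ AddSubgroup.closure (Set.range s) := by
        rw [Function.iterate_succ_apply']
        exact hΩ _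
      rw [eq_sum_of_mem_closure s ν hν hy]
      refine Finset.sum_eq_zero fun i _ => ?_
      have := congrFun (congrArg ν h) i
      rw [map_zsmul, map_zero, Pi.smul_apply, Pi.zero_apply, smul_eq_mul] at this
      rw [(mul_eq_zero.1 this).resolve_left hm, zero_smul]
    obtain ⟨Ωk, hΩk⟩ := exists_hom_eq_iterate Ω (k + 1)
    by_cases h0 : ∀ N ∈ I, f N = 0
    · have : AddSubgroup.closure I ≤ Ωk.ker := by
        rw [AddSubgroup.closure_le]
        intro N hN
        change Ωk N = 0
        rw [hΩk]
        exact hsingle N hN ((hf N).1 (h0 N hN))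
      have := this hxI
      rw [AddMonoidHom.mem_ker, hΩk] at this
      exact hx this
    · push Not at h0
      obtain ⟨N, hN, hfN⟩ := h0
      -- The combination `f N • y - f y • N` is in the kernel of `f`, and `g y` is its image under
      -- `Ω ^ (k + 1)`. By `hcon` the homomorphism `g` vanishes on `I`, hence at `x`.
      let g : G →+ G := f N • Ωk - (zmultiplesHom G (Ωk N)).comp f
      have hg : ∀ y, g y = f N • Ωk y - f y • Ωk N := fun y => rfl
      have : AddSubgroup.closure I ≤ g.ker := by
        rw [AddSubgroup.closure_le]
        intro N' hN'
        have h := hcon N' hN' N hN (f N) (-f N') ((hf _).1 (by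
          rw [map_add, map_zsmul, map_zsmul, smul_eq_mul, smul_eq_mul]; ring))
        rw [← hΩk, map_add, map_zsmul, map_zsmul, neg_smul, ← sub_eq_add_neg] at h
        exact h
      have h := this hxI
      rw [AddMonoidHom.mem_ker, hg, (hf x).2 hx', zero_smul, sub_zero, hΩk] at h
      exact hx (htf _ _ hfN h)

/-- Let `Ω` be an endomorphism of an abelian group whose image lies in a free summand of rank at
most `k + 1` with basis in `I`. If some element of the subgroup generated by `I` is killed by
`Ω ^ (k + 1)` and not by `Ω ^ k`, then so is an integral combination of two elements of `I`. -/
theorem exists_pair (Ω : G →+ G) (s : B → G) (ν : G →+ (B → ℤ))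
    (hν : ∀ i, ν (s i) = Pi.single i 1) (hΩ : ∀ x, Ω x ∈ AddSubgroup.closure (Set.range s))
    (I : Set G) (hs : ∀ i, s i ∈ I) (k : ℕ) (hB : Fintype.card B ≤ k + 1) {x : G}
    (hxI : x ∈ AddSubgroup.closure I) (hx : Ω^[k] x ≠ 0) (hx' : Ω^[k + 1] x = 0) :
    ∃ N₁ ∈ I, ∃ N₂ ∈ I, ∃ z ∈ AddSubgroup.closure {N₁, N₂}, Ω^[k] z ≠ 0 ∧ Ω^[k + 1] z = 0 := by
  obtain ⟨N₁, h₁, N₂, h₂, a, b, h⟩ := exists_pair_aux Ω s ν hν hΩ I hs k hB hxI hx hx'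
  have hm₁ : N₁ ∈ AddSubgroup.closure ({N₁, N₂} : Set G) :=
    AddSubgroup.subset_closure (Set.mem_insert _ _)
  have hm₂ : N₂ ∈ AddSubgroup.closure ({N₁, N₂} : Set G) :=
    AddSubgroup.subset_closure (Set.mem_insert_of_mem _ rfl)
  have hm : a • N₁ + b • N₂ ∈ AddSubgroup.closure ({N₁, N₂} : Set G) :=
    add_mem (zsmul_mem hm₁ a) (zsmul_mem hm₂ b)
  exact ⟨N₁, h₁, N₂, h₂, a • N₁ + b • N₂, hm, h.1, h.2⟩

end LinearAlgebra

/-! ### The Igusa–Todorov function in terms of elements killed by powers of `omegaBar` -/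

section PhiCriterion

variable {R : Type u} [Ring R] [IsArtinianRing R]

theorem mem_omegaBarPow {M : FGModuleCat.{u} R} {l : ℕ} {y : K0 R} :
    y ∈ omegaBarPow M l ↔ ∃ x ∈ addClosure M, (omegaBar R)^[l] x = y := by
  induction l generalizing y with
  | zero => simp [omegaBarPow]
  | succ l ih =>
    rw [omegaBarPow, AddSubgroup.mem_map]
    constructor
    · rintro ⟨z, hz, rfl⟩
      obtain ⟨x, hx, rfl⟩ := ih.1 hz
      exact ⟨x, hx, Function.iterate_succ_apply' _ _ _⟩
    · rintro ⟨x, hx, rfl⟩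
      exact ⟨_, ih.2 ⟨x, hx, rfl⟩, (Function.iterate_succ_apply' _ _ _).symm⟩

theorem le_phi {M : FGModuleCat.{u} R} {k : ℕ} {x : K0 R} (hx : x ∈ addClosure M)
    (h : (omegaBar R)^[k] x ≠ 0) (h' : (omegaBar R)^[k + 1] x = 0) :
    ((k + 1 : ℕ) : ℕ∞) ≤ phi M := by
  refine le_iInf₂ fun l hl => ?_
  by_contra! hlt
  have hlk : l ≤ k := by
    have : l < k + 1 := by exact_mod_cast hlt
    omega
  -- The one element `x` excludes every `l ≤ k`: injectivity fails at the shift `t = k - l`.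
  obtain ⟨t, rfl⟩ := Nat.exists_eq_add_of_le hlk
  refine h (hl t (mem_omegaBarPow.2 ⟨x, hx, rfl⟩) (zero_mem _) ?_)
  rw [map_zero, ← Function.iterate_succ_apply' (omegaBar R)]
  exact h'

/-- Injectivity must fail at some stage `k + t`; the difference of two elements with equal image
comes from the desired `x`. The stage need not be `k` itself, hence `m ≥ k`. -/
theorem exists_of_lt_phi {M : FGModuleCat.{u} R} {k : ℕ} (hk : (k : ℕ∞) < phi M) :
    ∃ m ≥ k, ∃ x ∈ addClosure M, (omegaBar R)^[m] x ≠ 0 ∧ (omegaBar R)^[m + 1] x = 0 := by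
  have hk' : ¬ ∀ t : ℕ, Set.InjOn (omegaBar R) (omegaBarPow M (k + t)) := fun h =>
    absurd (iInf₂_le (f := fun (l : ℕ) (_ : l ∈ {l : ℕ | ∀ t : ℕ,
      Set.InjOn (omegaBar R) (omegaBarPow M (l + t))}) => (l : ℕ∞)) k h) (not_le.2 hk)
  push Not at hk'
  obtain ⟨t, ht⟩ := hk'
  simp only [Set.InjOn, not_forall] at ht
  obtain ⟨a, ha, b, hb, hab, hne⟩ := ht
  obtain ⟨x, hx, hxe⟩ := mem_omegaBarPow.1 (sub_mem ha hb)
  refine ⟨k + t, by omega, x, hx, ?_, ?_⟩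
  · rw [hxe]; exact sub_ne_zero.2 hne
  · rw [Function.iterate_succ_apply', hxe, map_sub, hab, sub_self]

omit [IsArtinianRing R] in
theorem closure_pair_le_addClosure {N₁ N₂ : FGModuleCat.{u} R} (h₁ : IsIndecomposable R N₁)
    (h₂ : IsIndecomposable R N₂) :
    AddSubgroup.closure {cls N₁, cls N₂} ≤ addClosure (FGModuleCat.of R (N₁ × N₂)) := by
  rw [AddSubgroup.closure_le]
  rintro _ (rfl | rfl)
  · exact AddSubgroup.subset_closure ⟨N₁, N₂, h₁, ⟨LinearEquiv.refl R (N₁ × N₂)⟩, rfl⟩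
  · exact AddSubgroup.subset_closure ⟨N₂, N₁, h₂, ⟨LinearEquiv.prodComm R N₁ N₂⟩, rfl⟩

/-- If the image of `omegaBar` lies in a free summand of `K₀` with a basis of at most `φdim`
indecomposable modules, then the `φ`-dimension is attained on a sum of two indecomposables. -/
theorem exists_phi_eq_phiDim {B : Type*} [Fintype B] [DecidableEq B] (S : B → FGModuleCat.{u} R)
    (hS : ∀ i, IsIndecomposable R (S i)) (ν : K0 R →+ (B → ℤ))
    (hν : ∀ i, ν (cls (S i)) = Pi.single i 1)
    (hΩ : ∀ x, omegaBar R x ∈ AddSubgroup.closure (Set.range fun i => cls (S i)))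
    (hN : ∃ N : FGModuleCat.{u} R, IsIndecomposable R N)
    (d : ℕ) (hd : phiDim R = d) (hB : Fintype.card B ≤ d) :
    ∃ M₁ M₂ : FGModuleCat.{u} R, IsIndecomposable R M₁ ∧ IsIndecomposable R M₂ ∧
      phi (FGModuleCat.of R (M₁ × M₂)) = phiDim R := by
  have hle : ∀ M : FGModuleCat.{u} R, phi M ≤ phiDim R := fun M => le_iSup phi M
  cases d with
  | zero =>
    obtain ⟨N, hN⟩ := hN
    refine ⟨N, N, hN, hN, ?_⟩
    rw [hd]
    exact le_antisymm (hd ▸ hle _) (by simp)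
  | succ d =>
    have hlt : (d : ℕ∞) < ⨆ M : FGModuleCat.{u} R, phi M := by
      change _ < phiDim R
      rw [hd]
      exact_mod_cast Nat.lt_succ_self d
    obtain ⟨M, hM⟩ := lt_iSup_iff.1 hlt
    obtain ⟨m, hm, x, hxM, hx, hx'⟩ := exists_of_lt_phi hM
    have hxI : x ∈ AddSubgroup.closure
        {y : K0 R | ∃ N : FGModuleCat.{u} R, IsIndecomposable R N ∧ y = cls N} := by
      refine AddSubgroup.closure_mono ?_ hxM
      rintro _ ⟨N, N', hN, -, rfl⟩
      exact ⟨N, hN, rfl⟩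
    -- A larger `m` is harmless: the rank bound `d + 1 ≤ m + 1` persists, and the pair obtained has
    -- `phi` at least `m + 1 ≥ d + 1`.
    obtain ⟨_, ⟨N₁, h₁, rfl⟩, _, ⟨N₂, h₂, rfl⟩, z, hz, hz1, hz2⟩ :=
      exists_pair (omegaBar R) (fun i => cls (S i)) ν hν hΩ
        {y : K0 R | ∃ N : FGModuleCat.{u} R, IsIndecomposable R N ∧ y = cls N} (fun i => ⟨S i, hS i, rfl⟩) m
        (by omega) hxI hx hx'
    refine ⟨N₁, N₂, h₁, h₂, le_antisymm (hle _) ?_⟩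
    refine le_trans ?_ (le_phi (closure_pair_le_addClosure h₁ h₂ hz) hz1 hz2)
    rw [hd]
    exact_mod_cast Nat.add_le_add_right hm 1

end PhiCriterion

end IgusaTodorov

/-! ### Split basic algebras with radical square zero -/

namespace IgusaTodorov

/-- The data exhibiting a `K`-algebra `R` as a split basic algebra with radical square zero:
idempotents `e i`, characters `χ i` dual to them, whose common kernel has square zero. -/
structure RadSqZeroData (K : Type*) (R : Type u) (V : Type*) [Field K] [Ring R] [Algebra K R]
    [Fintype V] where
  e : V → R
  χ : V → R →ₐ[K] K
  e_mul_self : ∀ i, e i * e i = e i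
  sum_e : ∑ i, e i = 1
  χ_self : ∀ i, χ i (e i) = 1
  χ_ne : ∀ i j, i ≠ j → χ i (e j) = 0
  mul_eq_zero : ∀ r s, (∀ i, χ i r = 0) → (∀ i, χ i s = 0) → r * s = 0

namespace RadSqZeroData

variable {K : Type*} {R : Type u} {V : Type*} [Field K] [Ring R] [Algebra K R] [Fintype V]
  (D : RadSqZeroData K R V)

/-- The radical: the common kernel of the characters. -/
def rad : Ideal R := ⨅ i, RingHom.ker (D.χ i)

theorem mem_rad {r : R} : r ∈ D.rad ↔ ∀ i, D.χ i r = 0 := by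
  simp [rad, Submodule.mem_iInf]

theorem mul_mem_rad {r : R} (hr : r ∈ D.rad) (s : R) : r * s ∈ D.rad :=
  D.mem_rad.2 fun i => by rw [map_mul, D.mem_rad.1 hr, zero_mul]

theorem rad_mul_rad {r s : R} (hr : r ∈ D.rad) (hs : s ∈ D.rad) : r * s = 0 :=
  D.mul_eq_zero r s (D.mem_rad.1 hr) (D.mem_rad.1 hs)

theorem mul_e_mem_rad {i : V} {r : R} (hr : D.χ i r = 0) : r * D.e i ∈ D.rad := by
  refine D.mem_rad.2 fun k => ?_
  by_cases h : k = i
  · rw [h, map_mul, hr, zero_mul]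
  · rw [map_mul, D.χ_ne k i h, mul_zero]

theorem e_mul_mem_rad {i : V} {r : R} (hr : D.χ i r = 0) : D.e i * r ∈ D.rad := by
  refine D.mem_rad.2 fun k => ?_
  by_cases h : k = i
  · rw [h, map_mul, hr, mul_zero]
  · rw [map_mul, D.χ_ne k i h, zero_mul]

/-- A vertex `j` is a sink if `rad * e j = 0`. -/
def IsSink (j : V) : Prop := ∀ r ∈ D.rad, r * D.e j = 0

/-- A vertex `j` is a source if `e j * rad = 0`. -/
def IsSource (j : V) : Prop := ∀ r ∈ D.rad, D.e j * r = 0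

/-- The simple module at the vertex `i`. -/
abbrev simple (i : V) : FGModuleCat.{u} R := FGModuleCat.of R (R ⧸ RingHom.ker (D.χ i))

theorem isSimpleModule_simple (i : V) : IsSimpleModule R (R ⧸ RingHom.ker (D.χ i)) := by
  refine isSimpleModule_iff_toSpanSingleton_surjective.2 ⟨?_, ?_⟩
  · refine Submodule.Quotient.nontrivial_iff.2 fun h => ?_
    have : (1 : R) ∈ RingHom.ker (D.χ i) := h ▸ Submodule.mem_top
    rw [RingHom.mem_ker, map_one] at this
    exact one_ne_zero this
  · intro x hx y
    obtain ⟨r, rfl⟩ := Submodule.Quotient.mk_surjective _ x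
    obtain ⟨t, rfl⟩ := Submodule.Quotient.mk_surjective _ y
    have hr : D.χ i r ≠ 0 := fun h => hx ((Submodule.Quotient.mk_eq_zero _).2 h)
    refine ⟨t * algebraMap K R (D.χ i r)⁻¹, ?_⟩
    rw [LinearMap.toSpanSingleton_apply, ← Submodule.Quotient.mk_smul, Submodule.Quotient.eq,
      RingHom.mem_ker]
    simp [hr]

theorem isIndecomposable_simple (i : V) : IsIndecomposable R (D.simple i) := by
  have := D.isSimpleModule_simple i
  refine ⟨this.nontrivial, fun N N' h => ?_⟩
  rcases eq_bot_or_eq_top N with h' | h'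
  · exact Or.inl h'
  · exact Or.inr (by simpa [h'] using h.inf_eq_bot)

/-! ### Socles, the radical and projective modules -/

section Socle

variable {M : Type w} [AddCommGroup M] [Module R M]

/-- The `i`-th isotypic part of the socle. -/
def socle (i : V) (M : Type w) [AddCommGroup M] [Module R M] : Submodule R M where
  carrier := {m | D.e i • m = m ∧ ∀ r ∈ D.rad, r • m = 0}
  zero_mem' := ⟨smul_zero _, fun r _ => smul_zero r⟩
  add_mem' := fun {a b} ha hb => ⟨by rw [smul_add, ha.1, hb.1], fun r hr => by
    rw [smul_add, ha.2 r hr, hb.2 r hr, add_zero]⟩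
  smul_mem' := fun s m hm => by
    refine ⟨?_, fun r hr => ?_⟩
    -- Modulo the radical, `e i * s * e i` and `s * e i` agree, since only the character at `i` can
    -- distinguish them and it does not.
    · have h : (D.e i * s - s) * D.e i ∈ D.rad := D.mul_e_mem_rad (by
        rw [map_sub, map_mul, D.χ_self, one_mul, sub_self])
      have h2 := hm.2 _ h
      rw [mul_smul, hm.1, sub_smul, mul_smul, sub_eq_zero] at h2
      exact h2
    · rw [← mul_smul]
      exact hm.2 _ (D.mul_mem_rad hr s)

variable {D} {i : V}

theorem mem_socle {m : M} : m ∈ D.socle i M ↔ D.e i • m = m ∧ ∀ r ∈ D.rad, r • m = 0 := Iff.rfl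

theorem smul_eq_zero_of_mem_socle {m : M} (hm : m ∈ D.socle i M) {r : R} (hr : D.χ i r = 0) :
    r • m = 0 := by
  have := hm.2 _ (D.mul_e_mem_rad hr)
  rwa [mul_smul, hm.1] at this

/-- The annihilator of `m` is proper and contains the maximal left ideal `ker (χ i)`, so the two
coincide. -/
theorem exists_simple_equiv_span {m : M} (hm : m ∈ D.socle i M) (h0 : m ≠ 0) :
    ∃ e : (R ⧸ RingHom.ker (D.χ i)) ≃ₗ[R] Submodule.span R {m},
      ∀ r : R, ((e (Submodule.Quotient.mk r) : Submodule.span R {m}) : M) = r • m := by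
  have hcoatom : IsCoatom (RingHom.ker (D.χ i)) :=
    isSimpleModule_iff_isCoatom.1 (D.isSimpleModule_simple i)
  have hker : RingHom.ker (D.χ i) = LinearMap.ker (LinearMap.toSpanSingleton R M m) := by
    refine ((hcoatom.le_iff_eq fun h => h0 ?_).1 fun r hr => ?_).symm
    · have : (1 : R) ∈ LinearMap.ker (LinearMap.toSpanSingleton R M m) := h ▸ Submodule.mem_top
      simpa using this
    · rw [LinearMap.mem_ker, LinearMap.toSpanSingleton_apply]
      exact smul_eq_zero_of_mem_socle hm hr
  refine ⟨(Submodule.quotEquivOfEq _ _ hker).trans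
    ((LinearMap.toSpanSingleton R M m).quotKerEquivRange.trans
      (LinearEquiv.ofEq _ _ (LinearMap.range_toSpanSingleton m))), fun r => rfl⟩

theorem e_smul_mem_socle (hM : ∀ r ∈ D.rad, ∀ m : M, r • m = 0) (m : M) :
    D.e i • m ∈ D.socle i M :=
  ⟨by rw [← mul_smul, D.e_mul_self], fun r hr => hM r hr _⟩

theorem sum_e_smul (m : M) : ∑ i, D.e i • m = m := by
  rw [← Finset.sum_smul, D.sum_e, one_smul]

/-- The module is the sum of the submodules generated by the elements `e i • m`, each simple or
zero. -/
theorem isSemisimpleModule_of_rad_smul_eq_zero (hM : ∀ r ∈ D.rad, ∀ m : M, r • m = 0) :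
    IsSemisimpleModule R M := by
  refine isSemisimpleModule_of_isSemisimpleModule_submodule'
    (p := fun x : V × M => Submodule.span R {D.e x.1 • x.2}) ?_ ?_
  · rintro ⟨i, m⟩
    change IsSemisimpleModule R (Submodule.span R {D.e i • m})
    by_cases h : D.e i • m = 0
    · have : Subsingleton (Submodule.span R {D.e i • m}) := by
        rw [h, Submodule.span_zero_singleton]; infer_instance
      exact (isSemisimpleModule_iff R _).2 Subsingleton.instComplementedLattice
    · obtain ⟨f, -⟩ := exists_simple_equiv_span (e_smul_mem_socle hM m) h
      have := D.isSimpleModule_simple i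
      exact IsSemisimpleModule.congr f.symm
  · refine eq_top_iff.2 fun m _ => ?_
    rw [← sum_e_smul (D := D) m]
    exact Submodule.sum_mem _ fun i _ => Submodule.mem_iSup_of_mem (i, m)
      (Submodule.mem_span_singleton_self _)

theorem rad_smul_quotient_eq_zero (r : R) (hr : r ∈ D.rad)
    (m : M ⧸ (D.rad • (⊤ : Submodule R M))) : r • m = 0 := by
  obtain ⟨m, rfl⟩ := Submodule.Quotient.mk_surjective _ m
  rw [← Submodule.Quotient.mk_smul, Submodule.Quotient.mk_eq_zero]
  exact Submodule.smul_mem_smul hr Submodule.mem_top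

/-- A superfluous submodule lies in every maximal submodule, hence in the Jacobson radical of `M`,
which maps to zero in the semisimple quotient `M / rad M`. -/
theorem le_rad_smul_top_of_superfluous (N : Submodule R M)
    (hN : ∀ X : Submodule R M, X ⊔ N = ⊤ → X = ⊤) : N ≤ D.rad • (⊤ : Submodule R M) := by
  have h1 : N ≤ Module.jacobson R M := by
    refine le_sInf fun X hX => ?_
    by_contra hle
    have : X < X ⊔ N := lt_of_le_of_ne le_sup_left fun h => hle (h ▸ le_sup_right)
    exact hX.1 (hN X (hX.2 _ this))
  have := isSemisimpleModule_of_rad_smul_eq_zero (D := D)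
    (rad_smul_quotient_eq_zero (D := D) (M := M))
  refine h1.trans ?_
  have h2 := IsSemisimpleModule.jacobson_le_ker R R M _
    (D.rad • (⊤ : Submodule R M)).mkQ
  rwa [Submodule.ker_mkQ] at h2

theorem rad_smul_eq_zero_of_mem {m : M} (hm : m ∈ D.rad • (⊤ : Submodule R M)) {r : R}
    (hr : r ∈ D.rad) : r • m = 0 := by
  refine Submodule.smul_induction_on hm (fun s hs n _ => ?_) fun x y hx hy => ?_
  · rw [← mul_smul, D.rad_mul_rad hr hs, zero_smul]
  · rw [smul_add, hx, hy, add_zero]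

theorem source_smul_eq_zero_of_mem {m : M} (hm : m ∈ D.rad • (⊤ : Submodule R M))
    (hi : D.IsSource i) : D.e i • m = 0 := by
  refine Submodule.smul_induction_on hm (fun s hs n _ => ?_) fun x y hx hy => ?_
  · rw [← mul_smul, hi s hs, zero_smul]
  · rw [smul_add, hx, hy, add_zero]

theorem map_mem_rad_smul_top {N : Type*} [AddCommGroup N] [Module R N] (f : M →ₗ[R] N) {m : M}
    (hm : m ∈ D.rad • (⊤ : Submodule R M)) : f m ∈ D.rad • (⊤ : Submodule R N) := by
  refine Submodule.smul_induction_on hm (fun s hs n _ => ?_) fun x y hx hy => ?_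
  · rw [map_smul]; exact Submodule.smul_mem_smul hs Submodule.mem_top
  · rw [map_add]; exact add_mem hx hy

/-- Since `b = b * e i` and the radical has square zero, `b * z` is just `b` times the scalar `χ i
z`. -/
theorem χ_eq_zero_of_mul_eq_zero {b z : R} (hb : b ∈ D.rad) (hbi : b * D.e i = b) (hb0 : b ≠ 0)
    (hbz : b * z = 0) : D.χ i z = 0 := by
  by_contra h
  have h1 : b * (D.e i * (z - algebraMap K R (D.χ i z))) = 0 :=
    D.rad_mul_rad hb (D.e_mul_mem_rad (by simp))
  rw [← mul_assoc, hbi, mul_sub, hbz, zero_sub, neg_eq_zero] at h1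
  apply hb0
  have h2 : b * algebraMap K R (D.χ i z) * algebraMap K R (D.χ i z)⁻¹ = 0 := by rw [h1, zero_mul]
  rwa [mul_assoc, ← map_mul, mul_inv_cancel₀ h, map_one, mul_one] at h2

/-- In a projective module, an element of `e i P` which is killed by a nonzero element of
`rad * e i` lies in the radical. -/
theorem mem_rad_smul_top_of_projective [Module.Projective R M] {b : R} (hb : b ∈ D.rad)
    (hbi : b * D.e i = b) (hb0 : b ≠ 0) {y : M} (hy : D.e i • y = y) (hby : b • y = 0) :
    y ∈ D.rad • (⊤ : Submodule R M) := by
  -- A section into a free module reduces the claim to coordinates `z = e i * z` in `R` with `b * z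
  -- = 0`; these have `χ i z = 0` and so lie in the radical.
  obtain ⟨σ, hσ⟩ := Module.projective_def'.1 ‹Module.Projective R M›
  have hσy : Finsupp.linearCombination R id (σ y) = y := LinearMap.congr_fun hσ y
  rw [← hσy, Finsupp.linearCombination_apply]
  refine Submodule.sum_mem _ fun p _ => Submodule.smul_mem_smul ?_ Submodule.mem_top
  have h1 : b * σ y p = 0 := by
    have : σ (b • y) p = 0 := by rw [hby, map_zero]; rfl
    rwa [map_smul] at this
  have h2 : D.e i * σ y p = σ y p := by
    have : σ (D.e i • y) p = σ y p := by rw [hy]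
    rwa [map_smul] at this
  rw [← h2]
  exact D.e_mul_mem_rad (χ_eq_zero_of_mul_eq_zero hb hbi hb0 h1)

theorem exists_of_not_isSink (hi : ¬ D.IsSink i) :
    ∃ k, ∃ b ∈ D.rad, b ≠ 0 ∧ b * D.e i = b ∧ D.e k * b = b := by
  simp only [IsSink, not_forall] at hi
  obtain ⟨a, ha, ha0⟩ := hi
  obtain ⟨k, hk⟩ : ∃ k, D.e k * (a * D.e i) ≠ 0 := by
    by_contra! h
    apply ha0
    rw [← one_mul (a * D.e i), ← D.sum_e, Finset.sum_mul]
    exact Finset.sum_eq_zero fun k _ => h k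
  exact ⟨k, _, D.rad.mul_mem_left _ (D.mul_mem_rad ha _), hk,
    by rw [mul_assoc, mul_assoc, D.e_mul_self], by rw [← mul_assoc, D.e_mul_self]⟩

theorem exists_of_not_isSource (hi : ¬ D.IsSource i) :
    ∃ k, ∃ b ∈ D.rad, b ≠ 0 ∧ b * D.e k = b ∧ D.e i * b = b := by
  simp only [IsSource, not_forall] at hi
  obtain ⟨a, ha, ha0⟩ := hi
  obtain ⟨k, hk⟩ : ∃ k, D.e i * a * D.e k ≠ 0 := by
    by_contra! h
    apply ha0
    rw [← mul_one (D.e i * a), ← D.sum_e, Finset.mul_sum]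
    exact Finset.sum_eq_zero fun k _ => h k
  exact ⟨k, _, D.mul_mem_rad (D.rad.mul_mem_left _ ha) _, hk,
    by rw [mul_assoc, D.e_mul_self], by rw [mul_assoc, ← mul_assoc, D.e_mul_self]⟩

/-- This is why multiplicities vanish on projectives and descend to `K₀`. A vertex that is not a
sink supplies a nonzero `b` in `rad * e i`, and `b` kills the socle. -/
theorem socle_le_of_projective [Module.Projective R M] (hi : ¬ D.IsSink i) :
    D.socle i M ≤ D.rad • (⊤ : Submodule R M) := by
  obtain ⟨k, b, hb, hb0, hbi, -⟩ := exists_of_not_isSink hi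
  exact fun y hy => mem_rad_smul_top_of_projective hb hbi hb0 hy.1 (hy.2 b hb)

end Socle

theorem rad_smul_simple (i : V) (r : R) (hr : r ∈ D.rad) (m : R ⧸ RingHom.ker (D.χ i)) :
    r • m = 0 := by
  obtain ⟨m, rfl⟩ := Submodule.Quotient.mk_surjective _ m
  rw [← Submodule.Quotient.mk_smul, Submodule.Quotient.mk_eq_zero, RingHom.mem_ker]
  simp [D.mem_rad.1 hr]

theorem socle_simple_self (i : V) : D.socle i (R ⧸ RingHom.ker (D.χ i)) = ⊤ := by
  refine eq_top_iff.2 fun m _ => ⟨?_, fun r hr => D.rad_smul_simple i r hr m⟩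
  obtain ⟨m, rfl⟩ := Submodule.Quotient.mk_surjective _ m
  rw [← Submodule.Quotient.mk_smul, Submodule.Quotient.eq, RingHom.mem_ker]
  simp [D.χ_self]

theorem socle_simple_ne {i j : V} (h : i ≠ j) : D.socle j (R ⧸ RingHom.ker (D.χ i)) = ⊥ := by
  refine (Submodule.eq_bot_iff _).2 fun m hm => ?_
  rw [← hm.1]
  obtain ⟨m, rfl⟩ := Submodule.Quotient.mk_surjective _ m
  rw [← Submodule.Quotient.mk_smul, Submodule.Quotient.mk_eq_zero, RingHom.mem_ker]
  simp [D.χ_ne i j h]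

/-- At a sink, right multiplication by `e j` kills `ker (χ j)` and so splits the projection of `R`
onto the simple module. -/
theorem projective_simple {j : V} (hj : D.IsSink j) : Module.Projective R (D.simple j) := by
  let f : (R ⧸ RingHom.ker (D.χ j)) →ₗ[R] R :=
    Submodule.liftQ _ (LinearMap.toSpanSingleton R R (D.e j)) fun r hr => by
      rw [LinearMap.mem_ker, LinearMap.toSpanSingleton_apply, smul_eq_mul]
      have := hj _ (D.mul_e_mem_rad hr)
      rwa [mul_assoc, D.e_mul_self] at this
  refine Module.Projective.of_split f (Submodule.mkQ (RingHom.ker (D.χ j))) ?_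
  refine LinearMap.ext fun m => ?_
  obtain ⟨r, rfl⟩ := Submodule.Quotient.mk_surjective _ m
  change Submodule.Quotient.mk (r * D.e j) = (Submodule.Quotient.mk r : R ⧸ RingHom.ker (D.χ j))
  rw [Submodule.Quotient.eq, RingHom.mem_ker]
  simp [D.χ_self]

/-! ### Multiplicities of simple summands as functions on `K₀` -/

section Multiplicity

theorem length_toNat_eq_add [IsArtinianRing R] {M M' M'' : FGModuleCat.{u} R}
    (f : M ≃ₗ[R] M' × M'') (U : Submodule R M) (U' : Submodule R M') (U'' : Submodule R M'')
    (h : ∀ m, m ∈ U ↔ (f m).1 ∈ U' ∧ (f m).2 ∈ U'') :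
    (Module.length R U).toNat = (Module.length R U').toNat + (Module.length R U'').toNat := by
  let g : U ≃ₗ[R] U' × U'' :=
    { toFun := fun z => (⟨(f z).1, ((h _).1 z.2).1⟩, ⟨(f z).2, ((h _).1 z.2).2⟩)
      invFun := fun z => ⟨f.symm (z.1, z.2), (h _).2 (by simp)⟩
      map_add' := fun x y => by ext <;> simp
      map_smul' := fun c x => by ext <;> simp
      left_inv := fun z => by ext; simp
      right_inv := fun z => by ext <;> simp }
  rw [g.length_eq, Module.length_prod, ENat.toNat_add Module.length_ne_top Module.length_ne_top]

theorem mem_socle_iff_of_equiv {M M' M'' : Type*} [AddCommGroup M] [AddCommGroup M']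
    [AddCommGroup M''] [Module R M] [Module R M'] [Module R M''] (f : M ≃ₗ[R] M' × M'') (i : V)
    (m : M) : m ∈ D.socle i M ↔ (f m).1 ∈ D.socle i M' ∧ (f m).2 ∈ D.socle i M'' := by
  have h : ∀ r : R, ∀ m n : M, r • m = n ↔ r • (f m).1 = (f n).1 ∧ r • (f m).2 = (f n).2 := by
    intro r m n
    rw [← f.injective.eq_iff, map_smul, Prod.ext_iff]
    rfl
  simp only [mem_socle, h, map_zero, Prod.fst_zero, Prod.snd_zero]
  constructor
  · rintro ⟨h1, h2⟩
    exact ⟨⟨h1.1, fun r hr => (h2 r hr).1⟩, h1.2, fun r hr => (h2 r hr).2⟩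
  · rintro ⟨h1, h2⟩
    exact ⟨⟨h1.1, h2.1⟩, fun r hr => ⟨h1.2 r hr, h2.2 r hr⟩⟩

theorem mem_rad_smul_top_iff_of_equiv {M M' M'' : Type*} [AddCommGroup M] [AddCommGroup M']
    [AddCommGroup M''] [Module R M] [Module R M'] [Module R M''] (f : M ≃ₗ[R] M' × M'')
    (m : M) : m ∈ D.rad • (⊤ : Submodule R M) ↔
      (f m).1 ∈ D.rad • (⊤ : Submodule R M') ∧ (f m).2 ∈ D.rad • (⊤ : Submodule R M'') := by
  refine ⟨fun h => ⟨map_mem_rad_smul_top (LinearMap.fst R M' M'' ∘ₗ f.toLinearMap) h,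
    map_mem_rad_smul_top (LinearMap.snd R M' M'' ∘ₗ f.toLinearMap) h⟩, fun h => ?_⟩
  have h1 := map_mem_rad_smul_top (f.symm.toLinearMap ∘ₗ LinearMap.inl R M' M'') h.1
  have h2 := map_mem_rad_smul_top (f.symm.toLinearMap ∘ₗ LinearMap.inr R M' M'') h.2
  have h3 := add_mem h1 h2
  simp only [LinearMap.comp_apply, LinearEquiv.coe_coe, LinearMap.inl_apply,
    LinearMap.inr_apply] at h3
  rw [← map_add] at h3
  simpa using h3

/-- The multiplicity of the simple module at `i` as a direct summand of `M`. -/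
noncomputable def multiplicity (i : V) (M : FGModuleCat.{u} R) : ℤ :=
  -- Subtracting the part inside `rad M` discards the copies of the simple module that are not
  -- direct summands. Both lengths are additive on direct sums, so no uniqueness of decompositions
  -- is needed.
  (Module.length R (D.socle i M)).toNat -
    (Module.length R (D.socle i M ⊓ D.rad • ⊤ : Submodule R M)).toNat

variable [IsArtinianRing R]

theorem multiplicity_eq_add {M M' M'' : FGModuleCat.{u} R} (f : M ≃ₗ[R] M' × M'') (i : V) :
    D.multiplicity i M = D.multiplicity i M' + D.multiplicity i M'' := by
  unfold multiplicity
  rw [length_toNat_eq_add f _ _ _ (D.mem_socle_iff_of_equiv f i),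
    length_toNat_eq_add f (D.socle i M ⊓ D.rad • ⊤) (D.socle i M' ⊓ D.rad • ⊤)
      (D.socle i M'' ⊓ D.rad • ⊤) fun m => by
        rw [Submodule.mem_inf, Submodule.mem_inf, Submodule.mem_inf,
          D.mem_socle_iff_of_equiv f i, D.mem_rad_smul_top_iff_of_equiv f]
        tauto]
  push_cast
  ring

omit [IsArtinianRing R] in
theorem multiplicity_of_projective {i : V} (hi : ¬ D.IsSink i) (P : FGModuleCat.{u} R)
    (hP : Module.Projective R P) : D.multiplicity i P = 0 := by
  unfold multiplicity
  rw [inf_eq_left.2 (socle_le_of_projective hi), sub_self]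

omit [IsArtinianRing R] in
theorem multiplicity_simple_self (i : V) : D.multiplicity i (D.simple i) = 1 := by
  have := D.isSimpleModule_simple i
  have h1 : D.socle i (D.simple i) = ⊤ := D.socle_simple_self i
  have h2 : D.rad • (⊤ : Submodule R (D.simple i)) = ⊥ :=
    (Submodule.eq_bot_iff _).2 fun m hm =>
      Submodule.smul_induction_on hm (fun r hr n _ => D.rad_smul_simple i r hr n)
        fun x y hx hy => by rw [hx, hy, add_zero]
  unfold multiplicity
  rw [h1, h2, inf_bot_eq, Module.length_top, Module.length_bot]
  have h3 : Module.length R (D.simple i) = 1 := Module.length_eq_one R _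
  rw [h3]
  simp

omit [IsArtinianRing R] in
theorem multiplicity_simple_ne {i j : V} (h : i ≠ j) : D.multiplicity j (D.simple i) = 0 := by
  have h1 : D.socle j (D.simple i) = ⊥ := D.socle_simple_ne h
  unfold multiplicity
  rw [h1, bot_inf_eq, sub_self]

/-- The multiplicities of the simple modules at a set of vertices that are not sinks, as a
homomorphism on `K₀`. -/
theorem exists_multiplicityHom {B : Type*} (v : B → V) (hv : ∀ b, ¬ D.IsSink (v b)) :
    ∃ ν : K0 R →+ (B → ℤ), ∀ M b, ν (cls M) b = D.multiplicity (v b) M := by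
  refine ⟨QuotientAddGroup.lift _
    (FreeAbelianGroup.lift fun M b => D.multiplicity (v b) M) ?_, fun M b => ?_⟩
  · rw [AddSubgroup.closure_le]
    rintro _ (⟨M, M', M'', ⟨f⟩, rfl⟩ | ⟨P, hP, rfl⟩)
    · ext b
      simp [D.multiplicity_eq_add f]
    · ext b
      simp [D.multiplicity_of_projective (hv b) P hP]
  · change FreeAbelianGroup.lift (fun M b => D.multiplicity (v b) M) (FreeAbelianGroup.of M) b = _
    rw [FreeAbelianGroup.lift_apply_of]

end Multiplicity

/-! ### Syzygies are semisimple and avoid sources -/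

section Syzygy

variable [IsArtinianRing R]

omit [IsArtinianRing R] in
-- Simple summands are split off one at a time, by induction on a bound `n` for the length; `T`
-- records which vertices may occur.
theorem cls_mem_closure_of_rad_smul_eq_zero (n : ℕ) (X : FGModuleCat.{u} R)
    (hX : ∀ r ∈ D.rad, ∀ m : X, r • m = 0) (hn : Module.length R X ≤ n) (T : Set V)
    (hT : ∀ i, (∃ m : X, D.e i • m ≠ 0) → i ∈ T) :
    cls X ∈ AddSubgroup.closure ((fun i => cls (D.simple i)) '' T) := by
  induction n generalizing X with
  | zero =>
    have : Subsingleton X := Module.length_eq_zero_iff.1 (by simpa using hn)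
    rw [cls_of_projective X inferInstance]
    exact zero_mem _
  | succ n ih =>
    rcases subsingleton_or_nontrivial X with hX0 | hX0
    · rw [cls_of_projective X inferInstance]
      exact zero_mem _
    · obtain ⟨x, hx⟩ := exists_ne (0 : X)
      obtain ⟨i, hi⟩ : ∃ i, D.e i • x ≠ 0 := by
        by_contra! h
        exact hx ((sum_e_smul (D := D) x).symm.trans (Finset.sum_eq_zero fun i _ => h i))
      have := isSemisimpleModule_of_rad_smul_eq_zero hX
      obtain ⟨C, hC⟩ := exists_isCompl (Submodule.span R {D.e i • x})
      obtain ⟨f, -⟩ := exists_simple_equiv_span (e_smul_mem_socle hX x) hi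
      have hCtop : C ≠ ⊤ := by
        rintro rfl
        have h := hC.inf_eq_bot
        rw [inf_top_eq, Submodule.span_singleton_eq_bot] at h
        exact hi h
      have hlen : Module.length R C ≤ n := by
        have h := (Submodule.length_lt hCtop).trans_le hn
        push_cast at h
        exact (ENat.lt_add_one_iff (ENat.natCast_ne_top n)).1 h
      rw [cls_of_equiv_prod (M := X) (M' := D.simple i) (M'' := FGModuleCat.of R C)
        ((Submodule.prodEquivOfIsCompl _ _ hC).symm.trans
          (f.symm.prodCongr (LinearEquiv.refl R C)))]
      refine add_mem (AddSubgroup.subset_closure ⟨i, hT i ⟨x, hi⟩, rfl⟩) ?_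
      refine ih (FGModuleCat.of R C) (fun r hr m => Subtype.ext (hX r hr m.1)) hlen ?_
      rintro j ⟨m, hm⟩
      exact hT j ⟨m.1, fun h => hm (Subtype.ext h)⟩

theorem mem_rad_smul_of_mem_ker_cover (M : FGModuleCat.{u} R) (x : LinearMap.ker (cover M)) :
    (x : coverModule M) ∈ D.rad • (⊤ : Submodule R (coverModule M)) :=
  le_rad_smul_top_of_superfluous _ (isProjectiveCover_cover M).superfluous x.2

theorem rad_smul_syzygy (M : FGModuleCat.{u} R) (r : R) (hr : r ∈ D.rad) (m : syzygy M) :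
    r • m = 0 :=
  Subtype.ext (rad_smul_eq_zero_of_mem (D.mem_rad_smul_of_mem_ker_cover M m) hr)

/-- The syzygy sits in the radical of a projective. Sources do not occur because `e i` kills that
radical, and sinks contribute zero because their simples are projective. -/
theorem cls_syzygy_mem (M : FGModuleCat.{u} R) : cls (syzygy M) ∈ AddSubgroup.closure
    (Set.range fun i : {i // ¬ D.IsSink i ∧ ¬ D.IsSource i} => cls (D.simple i)) := by
  have h := D.cls_mem_closure_of_rad_smul_eq_zero (Module.length R (syzygy M)).toNat (syzygy M)
    (D.rad_smul_syzygy M) (by rw [ENat.natCast_toNat Module.length_ne_top]) {i | ¬ D.IsSource i} (by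
      rintro i ⟨m, hm⟩ hi
      exact hm (Subtype.ext
        (source_smul_eq_zero_of_mem (D.mem_rad_smul_of_mem_ker_cover M m) hi)))
  refine (AddSubgroup.closure_le _).2 ?_ h
  rintro _ ⟨i, hi, rfl⟩
  by_cases hs : D.IsSink i
  · change cls (D.simple i) ∈ _
    rw [cls_of_projective _ (D.projective_simple hs)]
    exact zero_mem _
  · exact AddSubgroup.subset_closure ⟨⟨i, hs, hi⟩, rfl⟩

theorem omegaBar_mem (x : K0 R) : omegaBar R x ∈ AddSubgroup.closure
    (Set.range fun i : {i // ¬ D.IsSink i ∧ ¬ D.IsSource i} => cls (D.simple i)) := by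
  have h : ∀ y : FreeAbelianGroup (FGModuleCat.{u} R),
      FreeAbelianGroup.lift (fun M : FGModuleCat.{u} R => cls (syzygy M)) y ∈
        AddSubgroup.closure
          (Set.range fun i : {i // ¬ D.IsSink i ∧ ¬ D.IsSource i} => cls (D.simple i)) := by
    intro y
    induction y using FreeAbelianGroup.induction_on with
    | zero => rw [map_zero]; exact zero_mem _
    | of M => rw [FreeAbelianGroup.lift_apply_of]; exact D.cls_syzygy_mem M
    | neg M _ => rw [map_neg, FreeAbelianGroup.lift_apply_of]; exact neg_mem (D.cls_syzygy_mem M)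
    | add x y hx hy => rw [map_add]; exact add_mem hx hy
  obtain ⟨y, rfl⟩ := QuotientAddGroup.mk_surjective x
  exact h y

theorem exists_phi_eq_phiDim [Nonempty V] (d : ℕ) (hd : phiDim R = d)
    (hB : Nat.card {i // ¬ D.IsSink i ∧ ¬ D.IsSource i} ≤ d) :
    ∃ M₁ M₂ : FGModuleCat.{u} R, IsIndecomposable R M₁ ∧ IsIndecomposable R M₂ ∧
      phi (FGModuleCat.of R (M₁ × M₂)) = phiDim R := by
  classical
  obtain ⟨ν, hν⟩ := D.exists_multiplicityHom
    (fun i : {i // ¬ D.IsSink i ∧ ¬ D.IsSource i} => (i : V)) fun i => i.2.1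
  have hν' : ∀ i : {i // ¬ D.IsSink i ∧ ¬ D.IsSource i},
      ν (cls (D.simple i)) = Pi.single i 1 := by
    intro i
    funext j
    rw [hν]
    by_cases h : i = j
    · subst h
      rw [D.multiplicity_simple_self, Pi.single_eq_same]
    · rw [D.multiplicity_simple_ne (fun h' => h (Subtype.ext h')),
        Pi.single_eq_of_ne (Ne.symm h)]
  have hN : ∃ N : FGModuleCat.{u} R, IsIndecomposable R N :=
    ⟨D.simple (Classical.arbitrary V), D.isIndecomposable_simple _⟩
  rw [Nat.card_eq_fintype_card] at hB
  exact IgusaTodorov.exists_phi_eq_phiDim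
    (fun i : {i // ¬ D.IsSink i ∧ ¬ D.IsSource i} => D.simple i)
    (fun i => D.isIndecomposable_simple i) ν hν' D.omegaBar_mem hN d hd hB

/-- As `j` is not a source, there is a nonzero `b = e j * b * e i` in the radical. Lift some `m`
with `e i • m ≠ 0` to `y` in the cover: `b • e i • y` is in the kernel, and if it were zero, `e i •
y` would lie in the radical and `e i • m` would vanish. -/
theorem e_smul_syzygy_ne_zero (hD : ∀ i, ¬ D.IsSource i) (M : FGModuleCat.{u} R)
    (hM : ∀ r ∈ D.rad, ∀ m : M, r • m = 0) (hM' : ∀ i, ∃ m : M, D.e i • m ≠ 0) (j : V) :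
    ∃ m : syzygy M, D.e j • m ≠ 0 := by
  obtain ⟨i, b, hb, hb0, hbi, hjb⟩ := exists_of_not_isSource (hD j)
  obtain ⟨m, hm⟩ := hM' i
  obtain ⟨y, rfl⟩ := (isProjectiveCover_cover M).surjective m
  have := (isProjectiveCover_cover M).projective
  have hker : b • D.e i • y ∈ LinearMap.ker (cover M) := by
    rw [LinearMap.mem_ker, map_smul, hM b hb]
  refine ⟨⟨b • D.e i • y, hker⟩, fun h => hm ?_⟩
  have h1 : D.e j • b • D.e i • y = 0 := congrArg Subtype.val h
  rw [← mul_smul, hjb] at h1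
  have h2 := mem_rad_smul_top_of_projective hb hbi hb0 (by rw [← mul_smul, D.e_mul_self]) h1
  have h3 := map_mem_rad_smul_top (cover M) h2
  rw [map_smul] at h3
  exact Submodule.smul_induction_on h3 (fun r hr n _ => hM r hr n)
    fun x y hx hy => by rw [hx, hy, add_zero]

theorem e_smul_syzygy_iterate_ne_zero (hD : ∀ i, ¬ D.IsSource i) (M : FGModuleCat.{u} R)
    (hM : ∀ r ∈ D.rad, ∀ m : M, r • m = 0) (hM' : ∀ i, ∃ m : M, D.e i • m ≠ 0) (n : ℕ) (j : V) :
    ∃ m : (syzygy^[n] M : FGModuleCat.{u} R), D.e j • m ≠ 0 := by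
  induction n generalizing M with
  | zero => exact hM' j
  | succ n ih =>
    exact ih (syzygy M) (D.rad_smul_syzygy M) (D.e_smul_syzygy_ne_zero hD M hM hM')

end Syzygy

/-! ### Cosyzygies when there are no sinks -/

section Cosyzygy

/-- Each nonzero component `e i • z` spans a simple submodule, which an essential submodule must
contain. -/
theorem mem_range_envelope (M : ModuleCat.{u} R) (z : envelopeModule M)
    (hz : ∀ r ∈ D.rad, r • z = 0) : z ∈ LinearMap.range (envelope M) := by
  rw [← sum_e_smul (D := D) z]
  refine Submodule.sum_mem _ fun i _ => ?_
  have hs : D.e i • z ∈ D.socle i (envelopeModule M) :=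
    ⟨by rw [← mul_smul, D.e_mul_self], fun r hr => by
      rw [← mul_smul]; exact hz _ (D.mul_mem_rad hr _)⟩
  by_cases h0 : D.e i • z = 0
  · rw [h0]; exact zero_mem _
  obtain ⟨f, -⟩ := exists_simple_equiv_span hs h0
  have := D.isSimpleModule_simple i
  have hsimple : IsSimpleModule R (Submodule.span R {D.e i • z}) := IsSimpleModule.congr f.symm
  have hatom : IsAtom (Submodule.span R {D.e i • z}) := isSimpleModule_iff_isAtom.1 hsimple
  rcases hatom.le_iff.1 (inf_le_left :
    Submodule.span R {D.e i • z} ⊓ LinearMap.range (envelope M) ≤ _) with h | h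
  · exact absurd ((isInjectiveEnvelope_envelope M).essential _ h) hatom.1
  · exact (h.symm ▸ inf_le_right : Submodule.span R {D.e i • z} ≤ LinearMap.range (envelope M))
      (Submodule.mem_span_singleton_self _)

theorem rad_smul_cosyzygy (M : ModuleCat.{u} R) (r : R) (hr : r ∈ D.rad) (m : cosyzygy M) :
    r • m = 0 := by
  obtain ⟨z, rfl⟩ := Submodule.Quotient.mk_surjective (LinearMap.range (envelope M)) m
  refine (Submodule.Quotient.mk_eq_zero _).2 (D.mem_range_envelope M _ fun s hs => ?_)
  rw [← mul_smul, D.rad_mul_rad hs hr, zero_smul]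

/-- As `j` is not a sink, there is a nonzero `b = e k * b * e j` in the radical, and it spans a copy
of the simple module at `k`. Injectivity extends the map sending `b` to a nonzero `e k • m` to a map
`h` on `R`. Then `e j • h 1` is not in the image of `M`: `b` kills that image, but takes `e j • h 1`
to `h b ≠ 0`. -/
theorem e_smul_cosyzygy_ne_zero (hD : ∀ i, ¬ D.IsSink i) (M : ModuleCat.{u} R)
    (hM : ∀ r ∈ D.rad, ∀ m : M, r • m = 0) (hM' : ∀ i, ∃ m : M, D.e i • m ≠ 0) (j : V) :
    ∃ m : cosyzygy M, D.e j • m ≠ 0 := by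
  obtain ⟨k, b, hb, hb0, hbj, hkb⟩ := exists_of_not_isSink (hD j)
  obtain ⟨m, hm⟩ := hM' k
  have hE := isInjectiveEnvelope_envelope M
  obtain ⟨f, hf⟩ := exists_simple_equiv_span (M := R) (m := b) (i := k)
    ⟨hkb, fun r hr => D.rad_mul_rad hr hb⟩ hb0
  obtain ⟨g, hg⟩ := exists_simple_equiv_span (e_smul_mem_socle (i := k) hM m) hm
  have := hE.injective_module
  obtain ⟨h, hh⟩ := Module.Injective.extension_property R (envelopeModule M)
    (Submodule.span R {b}) R (Submodule.span R {b}).subtype (Submodule.injective_subtype _)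
    (envelope M ∘ₗ (Submodule.subtype _) ∘ₗ g.toLinearMap ∘ₗ f.symm.toLinearMap)
  have hb1 : h b = envelope M (D.e k • m) := by
    have h1 := LinearMap.congr_fun hh (f (Submodule.Quotient.mk 1))
    simp only [LinearMap.comp_apply, Submodule.subtype_apply, LinearEquiv.coe_coe,
      LinearEquiv.symm_apply_apply] at h1
    rwa [hf, hg, one_smul, one_smul] at h1
  refine ⟨Submodule.Quotient.mk (h 1), fun h0 => ?_⟩
  obtain ⟨m', hm'⟩ := (Submodule.Quotient.mk_eq_zero (LinearMap.range (envelope M))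
    (x := D.e j • h 1)).1 h0
  have h2 : b • D.e j • h 1 = 0 := by rw [← hm', ← map_smul, hM b hb, map_zero]
  rw [← mul_smul, hbj, ← map_smul, smul_eq_mul, mul_one, hb1] at h2
  exact hm (hE.injective (h2.trans (map_zero _).symm))

theorem e_smul_cosyzygy_iterate_ne_zero (hD : ∀ i, ¬ D.IsSink i) (M : ModuleCat.{u} R)
    (hM : ∀ r ∈ D.rad, ∀ m : M, r • m = 0) (hM' : ∀ i, ∃ m : M, D.e i • m ≠ 0) (n : ℕ) (j : V) :
    ∃ m : (cosyzygy^[n] M : ModuleCat.{u} R), D.e j • m ≠ 0 := by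
  induction n generalizing M with
  | zero => exact hM' j
  | succ n ih =>
    exact ih (cosyzygy M) (D.rad_smul_cosyzygy M) (D.e_smul_cosyzygy_ne_zero hD M hM hM')

end Cosyzygy

end RadSqZeroData

end IgusaTodorov

/-! ### The radical square zero algebra of a quiver -/

namespace IgusaTodorov

namespace RadSqZeroData

variable {K : Type*} {R : Type u} {R' : Type w} {V : Type*} [Field K] [Ring R] [Algebra K R]
  [Ring R'] [Algebra K R'] [Fintype V]

/-- Transport along an isomorphism of algebras. -/
def congr (D : RadSqZeroData K R' V) (f : R ≃ₐ[K] R') : RadSqZeroData K R V where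
  e i := f.symm (D.e i)
  χ i := (D.χ i).comp f.toAlgHom
  e_mul_self i := by rw [← map_mul, D.e_mul_self]
  sum_e := by rw [← map_sum, D.sum_e, map_one]
  χ_self i := by simp [D.χ_self]
  χ_ne i j h := by simp [D.χ_ne i j h]
  mul_eq_zero r s hr hs := f.injective (by
    rw [map_mul, map_zero]
    exact D.mul_eq_zero _ _ hr hs)

theorem mem_rad_congr (D : RadSqZeroData K R' V) (f : R ≃ₐ[K] R') {r : R} :
    r ∈ (D.congr f).rad ↔ f r ∈ D.rad := by
  rw [mem_rad, mem_rad]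
  rfl

theorem isSink_congr (D : RadSqZeroData K R' V) (f : R ≃ₐ[K] R') {i : V} (h : D.IsSink i) :
    (D.congr f).IsSink i := fun r hr => f.injective (by
  rw [map_mul, map_zero]
  change f r * f (f.symm (D.e i)) = 0
  rw [f.apply_symm_apply]
  exact h _ ((D.mem_rad_congr f).1 hr))

theorem isSource_congr (D : RadSqZeroData K R' V) (f : R ≃ₐ[K] R') {i : V} (h : D.IsSource i) :
    (D.congr f).IsSource i := fun r hr => f.injective (by
  rw [map_mul, map_zero]
  change f (f.symm (D.e i)) * f r = 0
  rw [f.apply_symm_apply]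
  exact h _ ((D.mem_rad_congr f).1 hr))

end RadSqZeroData

section PathAlgebra

variable (K : Type*) [Field K] {V : Type*} [Quiver V]

/-- The coefficient of the trivial path at `i`. -/
noncomputable def nilCoeff (i : V) : PathAlgebra K V →ₗ[K] K :=
  (Finsupp.lapply (⟨i, i, Quiver.Path.nil⟩ : AnyPath V) : (AnyPath V →₀ K) →ₗ[K] K)

theorem nilCoeff_nil_self (i : V) : nilCoeff K i (ofPath K (Quiver.Path.nil : Quiver.Path i i)) = 1 :=
  Finsupp.single_eq_same

theorem nilCoeff_of_ne {i j k : V} (p : Quiver.Path j k)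
    (h : (⟨i, i, Quiver.Path.nil⟩ : AnyPath V) ≠ ⟨j, k, p⟩) : nilCoeff K i (ofPath K p) = 0 :=
  Finsupp.single_eq_of_ne h

theorem nilCoeff_nil_ne {i j : V} (h : i ≠ j) :
    nilCoeff K i (ofPath K (Quiver.Path.nil : Quiver.Path j j)) = 0 :=
  nilCoeff_of_ne K _ fun h' => h (congrArg Sigma.fst h')

theorem nilCoeff_of_length {i j k : V} (p : Quiver.Path j k) (hp : p.length ≠ 0) :
    nilCoeff K i (ofPath K p) = 0 :=
  nilCoeff_of_ne K _ fun h' => hp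
    (congrArg (fun q : AnyPath V => q.2.2.length) h').symm

variable [Fintype V]

theorem nilCoeff_ofPath_mul (i : V) {j k l m : V} (p : Quiver.Path j k) (q : Quiver.Path l m) :
    nilCoeff K i (ofPath K p * ofPath K q) =
      nilCoeff K i (ofPath K p) * nilCoeff K i (ofPath K q) := by
  by_cases h : l = k
  · subst h
    rw [ofPath_mul_ofPath]
    by_cases hp : p.length = 0
    · obtain rfl := Quiver.Path.eq_of_length_zero p hp
      obtain rfl := Quiver.Path.eq_nil_of_length_zero p hp
      rw [Quiver.Path.nil_comp]
      by_cases hij : i = j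
      · subst hij
        rw [nilCoeff_nil_self, one_mul]
      · rw [nilCoeff_nil_ne K hij, zero_mul]
        exact nilCoeff_of_ne K _ fun h' => hij (congrArg Sigma.fst h')
    · rw [nilCoeff_of_length K p hp, zero_mul]
      exact nilCoeff_of_length K _ (by rw [Quiver.Path.length_comp]; omega)
  · rw [ofPath_mul_ofPath_of_ne K p q h, map_zero]
    by_cases hp : p.length = 0
    · obtain rfl := Quiver.Path.eq_of_length_zero p hp
      obtain rfl := Quiver.Path.eq_nil_of_length_zero p hp
      by_cases hij : i = j
      · subst hij
        rw [nilCoeff_of_ne K q fun h' => h (congrArg Sigma.fst h').symm, mul_zero]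
      · rw [nilCoeff_nil_ne K hij, zero_mul]
    · rw [nilCoeff_of_length K p hp, zero_mul]

/-- The coefficient of the trivial path at `i`, as a character of the path algebra. -/
noncomputable def nilCoeffHom (i : V) : PathAlgebra K V →ₐ[K] K :=
  AlgHom.ofLinearMap (nilCoeff K i)
    (by
      change nilCoeff K i (pathOne K V) = 1
      rw [pathOne, map_sum, Finset.sum_eq_single i]
      · exact nilCoeff_nil_self K i
      · exact fun j _ h => nilCoeff_nil_ne K h.symm
      · simp)
    (fun x y => by
      induction x using pathAlgebra_induction with
      | h0 => rw [zero_mul, map_zero, zero_mul]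
      | hadd x x' h h' => rw [add_mul, map_add, map_add, add_mul, h, h']
      | hsmul a j k p =>
        induction y using pathAlgebra_induction with
        | h0 => rw [mul_zero, map_zero, mul_zero]
        | hadd y y' h h' => rw [mul_add, map_add, map_add, mul_add, h, h']
        | hsmul b l m q =>
          rw [smul_mul_smul_comm, map_smul, map_smul, map_smul, nilCoeff_ofPath_mul,
            smul_mul_smul_comm])

theorem nilCoeffHom_apply (i : V) (x : PathAlgebra K V) : nilCoeffHom K i x = nilCoeff K i x := rfl

theorem nilCoeffHom_eq_zero_of_mem (i : V) {x : PathAlgebra K V} (hx : x ∈ arrowIdeal K V) :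
    nilCoeffHom K i x = 0 := by
  have hle : TwoSidedIdeal.span
      {x : PathAlgebra K V | ∃ (i j : V) (a : i ⟶ j), x = ofPath K a.toPath} ≤
      TwoSidedIdeal.ker (nilCoeffHom K i) := by
    refine TwoSidedIdeal.span_le.2 ?_
    rintro _ ⟨j, k, a, rfl⟩
    exact (TwoSidedIdeal.mem_ker _).2 (nilCoeff_of_length K a.toPath (by
      rw [Quiver.Hom.toPath, Quiver.Path.length_cons]; omega))
  exact (TwoSidedIdeal.mem_ker _).1 (hle (TwoSidedIdeal.mem_asIdeal.1 hx))

/-- Every path of positive length ends in an arrow and so lies in the ideal. Hence `arrowIdeal` is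
the common kernel of the trivial-path coefficients. -/
theorem sub_sum_nilCoeff_mem (x : PathAlgebra K V) :
    x - ∑ i, nilCoeff K i x • ofPath K (Quiver.Path.nil : Quiver.Path i i) ∈ arrowIdeal K V := by
  have hsmul : ∀ (c : K) (y : PathAlgebra K V), y ∈ arrowIdeal K V → c • y ∈ arrowIdeal K V := by
    intro c y hy
    rw [Algebra.smul_def]
    exact Ideal.mul_mem_left _ _ hy
  induction x using pathAlgebra_induction with
  | h0 => simp
  | hadd x y h h' =>
    simp only [map_add, add_smul, Finset.sum_add_distrib]
    rw [add_sub_add_comm]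
    exact add_mem h h'
  | hsmul c j k p =>
    simp only [map_smul, smul_eq_mul, mul_smul]
    rw [← Finset.smul_sum, ← smul_sub]
    refine hsmul c _ ?_
    cases p with
    | nil =>
      rw [Finset.sum_eq_single j, nilCoeff_nil_self, one_smul, sub_self]
      · exact zero_mem _
      · intro i _ h
        rw [nilCoeff_nil_ne K h, zero_smul]
      · simp
    | cons p a =>
      rw [Finset.sum_eq_zero, sub_zero]
      · have : ofPath K (p.cons a) = ofPath K p * ofPath K a.toPath := by
          rw [ofPath_mul_ofPath]; rfl
        rw [this]
        exact Ideal.mul_mem_left _ _ (ofPath_toPath_mem K a)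
      · intro i _
        rw [nilCoeff_of_length K _ (by rw [Quiver.Path.length_cons]; omega), zero_smul]

theorem mem_arrowIdeal_iff {x : PathAlgebra K V} :
    x ∈ arrowIdeal K V ↔ ∀ i, nilCoeffHom K i x = 0 := by
  refine ⟨fun h i => nilCoeffHom_eq_zero_of_mem K i h, fun h => ?_⟩
  have := sub_sum_nilCoeff_mem K x
  rwa [Finset.sum_eq_zero, sub_zero] at this
  intro i _
  rw [← nilCoeffHom_apply, h i, zero_smul]

/-- The character of `K V / J²` given by the coefficient of the trivial path at `i`. -/
noncomputable def vertexChar (i : V) : RadSqZeroAlgebra K V →ₐ[K] K :=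
  Ideal.Quotient.liftₐ (arrowIdeal K V ^ 2) (nilCoeffHom K i) fun _ hx =>
    nilCoeffHom_eq_zero_of_mem K i (Ideal.pow_le_self two_ne_zero hx)

variable (V) in
/-- The opposite of `K V / J²` as an algebra with radical square zero. -/
noncomputable def radSqZeroData : RadSqZeroData K (RadSqZeroAlgebra K V)ᵐᵒᵖ V where
  -- Passing to the opposite reverses products: `IsSink j` for this data says that `e_j J = 0` in `K
  -- V / J²`, so that no arrow starts at `j`.
  e i := MulOpposite.op (idem K i)
  χ i := (vertexChar K i).fromOpposite fun _ _ => Commute.all _ _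
  e_mul_self i := by
    rw [← MulOpposite.op_mul, idem, ← map_mul, ofPath_mul_ofPath, Quiver.Path.comp_nil]
  sum_e := by
    have h : ∑ i : V, idem K i = 1 := by
      change ∑ i : V, Ideal.Quotient.mk (arrowIdeal K V ^ 2) _ = 1
      rw [← map_sum]
      exact map_one (Ideal.Quotient.mk (arrowIdeal K V ^ 2))
    rw [← MulOpposite.op_one, ← h]
    exact (map_sum (MulOpposite.opAddEquiv (α := RadSqZeroAlgebra K V)) _ _).symm
  χ_self i := nilCoeff_nil_self K i
  χ_ne i j h := nilCoeff_nil_ne K h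
  mul_eq_zero r s hr hs := by
    induction r using MulOpposite.rec' with | _ r
    induction s using MulOpposite.rec' with | _ s
    obtain ⟨x, rfl⟩ := Ideal.Quotient.mk_surjective r
    obtain ⟨y, rfl⟩ := Ideal.Quotient.mk_surjective s
    have hx : x ∈ arrowIdeal K V := (mem_arrowIdeal_iff K).2 hr
    have hy : y ∈ arrowIdeal K V := (mem_arrowIdeal_iff K).2 hs
    rw [← MulOpposite.op_mul, ← map_mul, Ideal.Quotient.eq_zero_iff_mem.2, MulOpposite.op_zero]
    rw [Submodule.pow_succ, Submodule.pow_one]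
    exact Ideal.mul_mem_mul hy hx

theorem rad_smul_semisimpleModule (r : (RadSqZeroAlgebra K V)ᵐᵒᵖ)
    (hr : r ∈ (radSqZeroData K V).rad) (m : semisimpleModule K V) : r • m = 0 := by
  induction r using MulOpposite.rec' with | _ r
  obtain ⟨x, rfl⟩ := Ideal.Quotient.mk_surjective r
  have hx : x ∈ arrowIdeal K V := (mem_arrowIdeal_iff K).2 ((radSqZeroData K V).mem_rad.1 hr)
  refine (op_smul_semisimple K V _ m).trans ?_
  have : toSemisimpleQuotient K V (Ideal.Quotient.mk _ x) = 0 := Ideal.Quotient.eq_zero_iff_mem.2 hx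
  rw [this]
  exact mul_zero (M₀ := PathAlgebra K V ⧸ arrowIdeal K V) m

theorem e_smul_semisimpleModule_ne_zero (i : V) :
    ∃ m : semisimpleModule K V, (radSqZeroData K V).e i • m ≠ 0 := by
  refine ⟨(1 : PathAlgebra K V ⧸ arrowIdeal K V), fun h => ?_⟩
  have h1 := (op_smul_semisimple K V (idem K i) 1).symm.trans h
  rw [one_mul] at h1
  have h2 : ofPath K (Quiver.Path.nil : Quiver.Path i i) ∈ arrowIdeal K V :=
    Ideal.Quotient.eq_zero_iff_mem.1 h1
  have h3 := nilCoeffHom_eq_zero_of_mem K i h2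
  rw [nilCoeffHom_apply, nilCoeff_nil_self] at h3
  exact one_ne_zero h3

variable [∀ i j : V, Finite (i ⟶ j)]

/-- If the member is not empty, the quiver has a sink or a source. -/
theorem exists_isSink_or_isSource (h : (member K V).Nonempty) :
    ∃ i, (radSqZeroData K V).IsSink i ∨ (radSqZeroData K V).IsSource i := by
  by_contra! hD
  obtain ⟨i, hi⟩ := h
  refine hi ⟨?_, ?_⟩
  · exact (radSqZeroData K V).e_smul_syzygy_iterate_ne_zero (fun j => (hD j).2) _
      (rad_smul_semisimpleModule K) (e_smul_semisimpleModule_ne_zero K) _ i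
  · exact (radSqZeroData K V).e_smul_cosyzygy_iterate_ne_zero (fun j => (hD j).1) _
      (rad_smul_semisimpleModule K) (e_smul_semisimpleModule_ne_zero K) _ i

end PathAlgebra

end IgusaTodorov

/-- Right `A`-modules are `Aᵐᵒᵖ`-modules. The assumption `[IsArtinianRing Aᵐᵒᵖ]` is automatic, as
`A ≅ K V / J²` is finite-dimensional; it only makes the definition of `Ω` available. -/
theorem corollary5p6 {K : Type*} [Field K] {V : Type*} [Quiver V] [Fintype V]
    [∀ i j : V, Finite (i ⟶ j)] [Nonempty V] [Subsingleton (Quiver.WeaklyConnectedComponent V)]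
    {A : Type u} [Ring A] [Algebra K A] [IsArtinianRing Aᵐᵒᵖ]
    (hA : Nonempty (A ≃ₐ[K] IgusaTodorov.RadSqZeroAlgebra K V))
    (hmax : IgusaTodorov.HasMaximalPhiDim K V A) :
    ∃ M₁ M₂ : FGModuleCat.{u} Aᵐᵒᵖ,
      IgusaTodorov.IsIndecomposable Aᵐᵒᵖ M₁ ∧ IgusaTodorov.IsIndecomposable Aᵐᵒᵖ M₂ ∧
      IgusaTodorov.phi (FGModuleCat.of Aᵐᵒᵖ (M₁ × M₂)) = IgusaTodorov.phiDim Aᵐᵒᵖ := by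
  classical
  obtain ⟨f⟩ := hA
  let D : IgusaTodorov.RadSqZeroData K Aᵐᵒᵖ V :=
    (IgusaTodorov.radSqZeroData K V).congr (AlgEquiv.op f)
  rcases hmax with ⟨-, hd⟩ | ⟨hne, hd⟩
  · refine D.exists_phi_eq_phiDim _ hd ?_
    rw [Nat.card_eq_fintype_card]
    exact Fintype.card_subtype_le _
  · refine D.exists_phi_eq_phiDim _ hd ?_
    rw [Nat.card_eq_fintype_card]
    obtain ⟨i, hi⟩ := IgusaTodorov.exists_isSink_or_isSource K hne
    -- Discarding one sink or source leaves at most `n - 1` vertices, which is exactly the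
    -- `φ`-dimension in this case.
    have hlt : Fintype.card {i // ¬ D.IsSink i ∧ ¬ D.IsSource i} < Fintype.card V := by
      refine Fintype.card_subtype_lt (x := i) fun h => ?_
      rcases hi with hi | hi
      · exact h.1 (IgusaTodorov.RadSqZeroData.isSink_congr _ _ hi)
      · exact h.2 (IgusaTodorov.RadSqZeroData.isSource_congr _ _ hi)
    omega
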